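/- Let $s\in(0,1)$, let $n\ge 1$ and $k\ge 2$ be integers, and assume $n>6s$. For $x\in\mathbb{R}^n$, $t>0$ put $$K_s(x,t)=\frac{t}{(t^{1/s}+|x|^2)^{\frac{n+2s}{2}}},\qquad \mathcal{T}^{out}[\mathcal{G}](x,t)=\int_t^\infty\int_{\mathbb{R}^n}K_s(x-y,l-t)\,|\mathcal{G}(y,l)|\,dy\,dl\in[0,\infty].$$ Let $p=\frac{n+2s}{n-2s}$ and let $U(y)=\alpha_{n,s}(1+|y|^2)^{-\frac{n-2s}{2}}$ with $\alpha_{n,s}=\Big(2^{2s}\frac{\Gamma(\frac{n+2s}{2})}{\Gamma(\frac{n-2s}{2})}\Big)^{\frac{n-2s}{4s}}$ (so that $(-\Delta)^sU=U^p$ on $\mathbb{R}^n$). Let $Z_{n+1}(y)=\frac{n-2s}{2}U(y)+y\cdot\nabla U(y)$ and $c=U(0)\frac{n-2s}{2}\frac{\int_{\mathbb{R}^n} U^p\,dy}{\int_{\mathbb{R}^n} Z_{n+1}^2\,dy}$. For $j\ge1$ put $$\alpha_j=\frac1{2s}\Big(\frac{n-2s}{n-6s}\Big)^{j-1}-\frac1{2s},\qquad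 \mu_{0,j}(t)=\beta_jt^{-\alpha_j},\qquad \beta_1=1,\quad \beta_j=(\alpha_jc^{-1})^{\frac{2}{n-6s}}\beta_{j-1}^{\frac{n-2s}{n-6s}}\ (j\ge2).$$ For $j\ge2$ put $\lambda_{0,j}=\mu_{0,j}/\mu_{0,j-1}$. Given parameters $\alpha,\sigma,\delta$, put $\bar\mu_{0,1}(t)=t^\delta$ and $\gamma_1=-1-\sigma$, and for $j\ge2$ put $\bar\mu_{0,j}=\sqrt{\mu_{0,j}\mu_{0,j-1}}$ and $\gamma_j=\frac{n-2s}{2}\alpha_{j-1}-\sigma$. Define the weights $$\omega_{1,1}=\frac{t^{-1-\sigma}}{1+|x|^{2s+\alpha}}1_{\{|x|\le2\bar\mu_{0,1}\}},\qquad \omega_{1,1}'=t^{\gamma_1}\bar\mu_{0,1}^{n-2s-\alpha}|x|^{-s-n}1_{\{\bar\mu_{0,1}\le|x|\le t^{\frac1{2s}}\}}+t^{\gamma_1}|x|^{-n-2s}1_{\{|x|\ge t^{\frac1{2s}}\}},$$ $$\omega_{1,j}=\frac{t^{-\sigma}}{\mu_{0,j}^{\frac{n+2s}2}}\,\frac{\lambda_{0,j}^{\frac{n-2s}2}}{1+(|x|/\mu_{0,j})^{2s+\alpha}}1_{\{|x|\le2\bar\mu_{0,j}\}}\quad(2\le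 j\le k),$$ $$\omega_{1,j}'=\mu_{0,j}^nt^{\gamma_j}|x|^{-n-2s}1_{\{|x|\ge\bar\mu_{0,j}\}},\qquad \omega_{1,j}''=\bar\mu_{0,j}^nt^{\gamma_j}|x|^{-n-2s}1_{\{|x|\ge\bar\mu_{0,j}\}}\quad(2\le j\le k),$$ $$\omega_{2,1}=t^{-\sigma}\mu_{0,2}^{\frac n2-2s}\mu_{0,1}^{-s}|x|^{2s-n}1_{\{\bar\mu_{0,2}\le|x|\le1\}},\qquad \omega_{2,j}=t^{-\sigma}\mu_{0,j+1}^{\frac n2-2s}\mu_{0,j}^{-s}|x|^{2s-n}1_{\{\bar\mu_{0,j+1}\le|x|\le\bar\mu_{0,j}\}}\quad(2\le j\le k-1),$$ $$\omega_3=t^{\delta(n-4s)}\,t^{-1-\sigma}|x|^{2s-n}1_{\{|x|\ge\bar\mu_{0,1}\}}.$$ Then there is $t_0\ge1$, depending only on $n,s,k$, such that for all $\alpha\in(0,s)$, $\sigma\in(0,1)$ and $\delta>0$ with $\delta(n-4s)<\sigma$ there is a constant $C>0$, depending only on $n,s,k,\alpha,\sigma,\delta$, such that for all $x\in\mathbb{R}^n$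 and $t>t_0$ all of the following hold. (In each piecewise definition the first case that applies is the one used.) $$\mathcal{T}^{out}[\omega_{1,1}]\le C\,\omega_{1,1}^*,\qquad \omega_{1,1}^*=\begin{cases}t^{\gamma_1}&|x|\le1,\\ t^{\gamma_1}|x|^{-\alpha}&1\le|x|\le2\bar\mu_{0,1},\\ t^{\gamma_1+\delta(n-2s-\alpha)}|x|^{2s-n}&|x|\ge2\bar\mu_{0,1};\end{cases}$$ $$\mathcal{T}^{out}[\omega_{1,1}']\le C\,(\omega_{1,1}')^*,\qquad (\omega_{1,1}')^*=\begin{cases}t^{\gamma_1-\delta(s+\alpha)}&|x|\le\bar\mu_{0,1},\\ t^{\gamma_1+(n-3s-\alpha)\delta}|x|^{2s-n}&|x|\ge\bar\mu_{0,1};\end{cases}$$ $$\mathcal{T}^{out}[\omega_{1,j}]\le C\,\omega_{1,j}^*,\qquad \omega_{1,j}^*=\begin{cases}t^{\gamma_j}&|x|\le4\bar\mu_{0,j},\\ t^{\gamma_j}\mu_{0,j}^\alpha\bar\mu_{0,j}^{n-2s-\alpha}|x|^{2s-n}&|x|\ge4\bar\mu_{0,j},\end{cases}\quad j=2,\dots,k;$$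 $$\mathcal{T}^{out}[\omega_{2,1}]\le C\,\omega_{2,1}^*,\qquad \omega_{2,1}^*=\begin{cases}t^{-\sigma}&|x|\le\bar\mu_{0,2},\\ t^{-\sigma}\bar\mu_{0,2}^{n-4s}|x|^{4s-n}&\bar\mu_{0,2}\le|x|\le1,\\ t^{-\sigma}\bar\mu_{0,2}^{n-4s}|x|^{2s-n}&|x|\ge1;\end{cases}$$ $$\mathcal{T}^{out}[\omega_{2,j}]\le C\,\omega_{2,j}^*,\qquad \omega_{2,j}^*=\begin{cases}t^{-\sigma}\mu_{0,j}^{s-\frac n2}&|x|\le\bar\mu_{0,j+1},\\ t^{-\sigma}\mu_{0,j+1}^{\frac n2-2s}\mu_{0,j}^{-s}|x|^{4s-n}&\bar\mu_{0,j+1}\le|x|\le\bar\mu_{0,j},\\ t^{-\sigma}\mu_{0,j+1}^{\frac n2-2s}\mu_{0,j-1}^{s}|x|^{2s-n}&|x|\ge\bar\mu_{0,j},\end{cases}\quad j=2,\dots,k-1;$$ $$\mathcal{T}^{out}[\omega_3]\le C\,\omega_3^*,\qquad \omega_3^*=t^{\delta(n-4s)}\cdot\begin{cases}t^{-1-\sigma}\bar\mu_{0,1}^{4s-n}&|x|\le\bar\mu_{0,1},\\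 t^{-1-\sigma}|x|^{4s-n}&\bar\mu_{0,1}\le|x|\le t^{\frac1{2s}},\\ t^{-\sigma}|x|^{2s-n}&|x|\ge t^{\frac1{2s}};\end{cases}$$ $$\mathcal{T}^{out}[\omega_{1,j}']\le C\,(\omega_{1,j}')^*,\qquad (\omega_{1,j}')^*=\begin{cases}\mu_{0,j}^nt^{\gamma_j}\bar\mu_{0,j}^{-n}&|x|\le\bar\mu_{0,j},\\ \mu_{0,j}^nt^{\gamma_j}\bar\mu_{0,j}^{-2s}|x|^{2s-n}&|x|\ge\bar\mu_{0,j},\end{cases}\quad j=2,\dots,k;$$ $$\mathcal{T}^{out}[\omega_{1,j}'']\le C\,(\omega_{1,j}'')^*,\qquad (\omega_{1,j}'')^*=\begin{cases}t^{\gamma_j}&|x|\le\bar\mu_{0,j},\\ \bar\mu_{0,j}^{n-2s}t^{\gamma_j}|x|^{2s-n}&|x|\ge\bar\mu_{0,j},\end{cases}\quad j=2,\dots,k.$$ -/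

import Mathlib

open MeasureTheory Set

namespace BubbleTower

noncomputable section

/-- The function comparable to the kernel of `∂ₜ + (-Δ)ˢ` on `ℝⁿ`:
`K_s(x,t) = t / (t^{1/s} + |x|²)^{(n+2s)/2}`. -/
def heatKernel (n : ℕ) (s : ℝ) (x : EuclideanSpace ℝ (Fin n)) (t : ℝ) : ℝ :=
  t / (t ^ (1 / s) + ‖x‖ ^ 2) ^ (((n : ℝ) + 2 * s) / 2)

/-- The backward Duhamel operator
`T^out[G](x,t) = ∫_t^∞ ∫_{ℝⁿ} K_s(x-y, l-t) |G(y,l)| dy dl`, with values in `[0,∞]`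
(the integrand is nonnegative). -/
def Tout (n : ℕ) (s : ℝ) (G : EuclideanSpace ℝ (Fin n) → ℝ → ℝ)
    (x : EuclideanSpace ℝ (Fin n)) (t : ℝ) : ENNReal :=
  ∫⁻ l in Ioi t, ∫⁻ y, ENNReal.ofReal (heatKernel n s (x - y) (l - t) * |G y l|)

/-- The bubble `U(y) = α_{n,s} (1+|y|²)^{-(n-2s)/2}`, with the constant `α_{n,s}` for which
`(-Δ)ˢ U = U^{(n+2s)/(n-2s)}`. -/
def bubble (n : ℕ) (s : ℝ) (y : EuclideanSpace ℝ (Fin n)) : ℝ :=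
  ((2 : ℝ) ^ (2 * s) * Real.Gamma (((n : ℝ) + 2 * s) / 2) / Real.Gamma (((n : ℝ) - 2 * s) / 2))
      ^ (((n : ℝ) - 2 * s) / (4 * s))
    * (1 / (1 + ‖y‖ ^ 2)) ^ (((n : ℝ) - 2 * s) / 2)

/-- `Z_{n+1}(y) = (n-2s)/2 U(y) + y · ∇U(y)`. -/
def dilationKernel (n : ℕ) (s : ℝ) (y : EuclideanSpace ℝ (Fin n)) : ℝ :=
  ((n : ℝ) - 2 * s) / 2 * bubble n s y + fderiv ℝ (bubble n s) y y

/-- `c = U(0) (n-2s)/2 (∫ U^p) / (∫ Z_{n+1}²)`, `p = (n+2s)/(n-2s)`. -/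
def cConst (n : ℕ) (s : ℝ) : ℝ :=
  bubble n s 0 * (((n : ℝ) - 2 * s) / 2)
    * (∫ y, bubble n s y ^ (((n : ℝ) + 2 * s) / ((n : ℝ) - 2 * s)))
    / (∫ y, dilationKernel n s y ^ 2)

/-- `α_j = (1/2s) ((n-2s)/(n-6s))^{j-1} - 1/2s`, for `j ≥ 1`. -/
def aExp (n : ℕ) (s : ℝ) (j : ℕ) : ℝ :=
  1 / (2 * s) * (((n : ℝ) - 2 * s) / ((n : ℝ) - 6 * s)) ^ (j - 1) - 1 / (2 * s)

/-- `β_1 = 1`, `β_j = (α_j / c)^{2/(n-6s)} β_{j-1}^{(n-2s)/(n-6s)}` for `j ≥ 2`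
(the value at `0` is not used). -/
def bCoef (n : ℕ) (s : ℝ) : ℕ → ℝ
  | 0 => 1
  | 1 => 1
  | (j + 2) =>
      (aExp n s (j + 2) * (cConst n s)⁻¹) ^ (2 / ((n : ℝ) - 6 * s))
        * bCoef n s (j + 1) ^ (((n : ℝ) - 2 * s) / ((n : ℝ) - 6 * s))

/-- `μ_{0,j}(t) = β_j t^{-α_j}`, for `j ≥ 1`. -/
def mu (n : ℕ) (s : ℝ) (j : ℕ) (t : ℝ) : ℝ :=
  bCoef n s j * t ^ (-aExp n s j)

/-- `λ_{0,j} = μ_{0,j} / μ_{0,j-1}`, for `j ≥ 2`. -/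
def lam (n : ℕ) (s : ℝ) (j : ℕ) (t : ℝ) : ℝ :=
  mu n s j t / mu n s (j - 1) t

/-- `μ̄_{0,1} = t^δ`, and `μ̄_{0,j} = √(μ_{0,j} μ_{0,j-1})` for `j ≥ 2`. -/
def muBar (n : ℕ) (s δ : ℝ) (j : ℕ) (t : ℝ) : ℝ :=
  if j = 1 then t ^ δ else Real.sqrt (mu n s j t * mu n s (j - 1) t)

/-- `γ_1 = -1-σ`, and `γ_j = (n-2s)/2 α_{j-1} - σ` for `j ≥ 2`. -/
def gam (n : ℕ) (s σ : ℝ) (j : ℕ) : ℝ :=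
  if j = 1 then -1 - σ else ((n : ℝ) - 2 * s) / 2 * aExp n s (j - 1) - σ

open Classical in
/-- The characteristic function of a condition. -/
def ind (P : Prop) : ℝ := if P then 1 else 0

section weights

/-- `ω_{1,1}` -/
def w11 (n : ℕ) (s α σ δ : ℝ) (x : EuclideanSpace ℝ (Fin n)) (t : ℝ) : ℝ :=
  t ^ (-1 - σ) / (1 + ‖x‖ ^ (2 * s + α)) * ind (‖x‖ ≤ 2 * muBar n s δ 1 t)

/-- `ω_{1,1}'` -/
def w11' (n : ℕ) (s α σ δ : ℝ) (x : EuclideanSpace ℝ (Fin n)) (t : ℝ) : ℝ :=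
  t ^ gam n s σ 1 * muBar n s δ 1 t ^ ((n : ℝ) - 2 * s - α) * ‖x‖ ^ (-s - (n : ℝ))
      * ind (muBar n s δ 1 t ≤ ‖x‖ ∧ ‖x‖ ≤ t ^ (1 / (2 * s)))
    + t ^ gam n s σ 1 * ‖x‖ ^ (-(n : ℝ) - 2 * s) * ind (t ^ (1 / (2 * s)) ≤ ‖x‖)

/-- `ω_{1,j}`, `j ≥ 2` -/
def w1 (n : ℕ) (s α σ δ : ℝ) (j : ℕ) (x : EuclideanSpace ℝ (Fin n)) (t : ℝ) : ℝ :=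
  t ^ (-σ) / mu n s j t ^ (((n : ℝ) + 2 * s) / 2)
    * (lam n s j t ^ (((n : ℝ) - 2 * s) / 2) / (1 + (‖x‖ / mu n s j t) ^ (2 * s + α)))
    * ind (‖x‖ ≤ 2 * muBar n s δ j t)

/-- `ω_{1,j}'`, `j ≥ 2` -/
def w1' (n : ℕ) (s σ δ : ℝ) (j : ℕ) (x : EuclideanSpace ℝ (Fin n)) (t : ℝ) : ℝ :=
  mu n s j t ^ (n : ℝ) * t ^ gam n s σ j * ‖x‖ ^ (-(n : ℝ) - 2 * s)
    * ind (muBar n s δ j t ≤ ‖x‖)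

/-- `ω_{1,j}''`, `j ≥ 2` -/
def w1'' (n : ℕ) (s σ δ : ℝ) (j : ℕ) (x : EuclideanSpace ℝ (Fin n)) (t : ℝ) : ℝ :=
  muBar n s δ j t ^ (n : ℝ) * t ^ gam n s σ j * ‖x‖ ^ (-(n : ℝ) - 2 * s)
    * ind (muBar n s δ j t ≤ ‖x‖)

/-- `ω_{2,1}` -/
def w21 (n : ℕ) (s σ δ : ℝ) (x : EuclideanSpace ℝ (Fin n)) (t : ℝ) : ℝ :=
  t ^ (-σ) * mu n s 2 t ^ ((n : ℝ) / 2 - 2 * s) * mu n s 1 t ^ (-s) * ‖x‖ ^ (2 * s - (n : ℝ))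
    * ind (muBar n s δ 2 t ≤ ‖x‖ ∧ ‖x‖ ≤ 1)

/-- `ω_{2,j}`, `j ≥ 2` -/
def w2 (n : ℕ) (s σ δ : ℝ) (j : ℕ) (x : EuclideanSpace ℝ (Fin n)) (t : ℝ) : ℝ :=
  t ^ (-σ) * mu n s (j + 1) t ^ ((n : ℝ) / 2 - 2 * s) * mu n s j t ^ (-s)
    * ‖x‖ ^ (2 * s - (n : ℝ))
    * ind (muBar n s δ (j + 1) t ≤ ‖x‖ ∧ ‖x‖ ≤ muBar n s δ j t)

/-- `ω_3` -/
def w3 (n : ℕ) (s σ δ : ℝ) (x : EuclideanSpace ℝ (Fin n)) (t : ℝ) : ℝ :=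
  t ^ (δ * ((n : ℝ) - 4 * s)) * t ^ (-1 - σ) * ‖x‖ ^ (2 * s - (n : ℝ))
    * ind (muBar n s δ 1 t ≤ ‖x‖)

end weights

section bounds

/-- `ω_{1,1}^*` -/
def w11Star (n : ℕ) (s α σ δ : ℝ) (x : EuclideanSpace ℝ (Fin n)) (t : ℝ) : ℝ :=
  if ‖x‖ ≤ 1 then t ^ gam n s σ 1
  else if ‖x‖ ≤ 2 * muBar n s δ 1 t then t ^ gam n s σ 1 * ‖x‖ ^ (-α)
  else t ^ (gam n s σ 1 + δ * ((n : ℝ) - 2 * s - α)) * ‖x‖ ^ (2 * s - (n : ℝ))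

/-- `(ω_{1,1}')^*` -/
def w11'Star (n : ℕ) (s α σ δ : ℝ) (x : EuclideanSpace ℝ (Fin n)) (t : ℝ) : ℝ :=
  if ‖x‖ ≤ muBar n s δ 1 t then t ^ (gam n s σ 1 - δ * (s + α))
  else t ^ (gam n s σ 1 + ((n : ℝ) - 3 * s - α) * δ) * ‖x‖ ^ (2 * s - (n : ℝ))

/-- `ω_{1,j}^*`, `j ≥ 2` -/
def w1Star (n : ℕ) (s α σ δ : ℝ) (j : ℕ) (x : EuclideanSpace ℝ (Fin n)) (t : ℝ) : ℝ :=
  if ‖x‖ ≤ 4 * muBar n s δ j t then t ^ gam n s σ j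
  else t ^ gam n s σ j * mu n s j t ^ α * muBar n s δ j t ^ ((n : ℝ) - 2 * s - α)
    * ‖x‖ ^ (2 * s - (n : ℝ))

/-- `(ω_{1,j}')^*`, `j ≥ 2` -/
def w1'Star (n : ℕ) (s σ δ : ℝ) (j : ℕ) (x : EuclideanSpace ℝ (Fin n)) (t : ℝ) : ℝ :=
  if ‖x‖ ≤ muBar n s δ j t then
    mu n s j t ^ (n : ℝ) * t ^ gam n s σ j * muBar n s δ j t ^ (-(n : ℝ))
  else mu n s j t ^ (n : ℝ) * t ^ gam n s σ j * muBar n s δ j t ^ (-(2 * s))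
    * ‖x‖ ^ (2 * s - (n : ℝ))

/-- `(ω_{1,j}'')^*`, `j ≥ 2` -/
def w1''Star (n : ℕ) (s σ δ : ℝ) (j : ℕ) (x : EuclideanSpace ℝ (Fin n)) (t : ℝ) : ℝ :=
  if ‖x‖ ≤ muBar n s δ j t then t ^ gam n s σ j
  else muBar n s δ j t ^ ((n : ℝ) - 2 * s) * t ^ gam n s σ j * ‖x‖ ^ (2 * s - (n : ℝ))

/-- `ω_{2,1}^*` -/
def w21Star (n : ℕ) (s σ δ : ℝ) (x : EuclideanSpace ℝ (Fin n)) (t : ℝ) : ℝ :=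
  if ‖x‖ ≤ muBar n s δ 2 t then t ^ (-σ)
  else if ‖x‖ ≤ 1 then
    t ^ (-σ) * muBar n s δ 2 t ^ ((n : ℝ) - 4 * s) * ‖x‖ ^ (4 * s - (n : ℝ))
  else t ^ (-σ) * muBar n s δ 2 t ^ ((n : ℝ) - 4 * s) * ‖x‖ ^ (2 * s - (n : ℝ))

/-- `ω_{2,j}^*`, `j ≥ 2` -/
def w2Star (n : ℕ) (s σ δ : ℝ) (j : ℕ) (x : EuclideanSpace ℝ (Fin n)) (t : ℝ) : ℝ :=
  if ‖x‖ ≤ muBar n s δ (j + 1) t then t ^ (-σ) * mu n s j t ^ (s - (n : ℝ) / 2)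
  else if ‖x‖ ≤ muBar n s δ j t then
    t ^ (-σ) * mu n s (j + 1) t ^ ((n : ℝ) / 2 - 2 * s) * mu n s j t ^ (-s)
      * ‖x‖ ^ (4 * s - (n : ℝ))
  else t ^ (-σ) * mu n s (j + 1) t ^ ((n : ℝ) / 2 - 2 * s) * mu n s (j - 1) t ^ s
    * ‖x‖ ^ (2 * s - (n : ℝ))

/-- `ω_3^*` -/
def w3Star (n : ℕ) (s σ δ : ℝ) (x : EuclideanSpace ℝ (Fin n)) (t : ℝ) : ℝ :=
  t ^ (δ * ((n : ℝ) - 4 * s)) *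
    (if ‖x‖ ≤ muBar n s δ 1 t then t ^ (-1 - σ) * muBar n s δ 1 t ^ (4 * s - (n : ℝ))
    else if ‖x‖ ≤ t ^ (1 / (2 * s)) then t ^ (-1 - σ) * ‖x‖ ^ (4 * s - (n : ℝ))
    else t ^ (-σ) * ‖x‖ ^ (2 * s - (n : ℝ)))

end bounds

end

end BubbleTower

/-! The kernel is at most `τ^(-n/(2s))` and at most `τ |z|^(-n-2s)`. It therefore has bounded mass
in space, and its integral over all times is at most a multiple of the Riesz kernel `|z|^(2s-n)`. A
weight with a time-independent majorant thus reduces to an elliptic problem: the Riesz potential of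
`max(R,|y|)^(-a)` with `a > 2s` is `O(R^(2s-a))`, uniformly in `x` (`Tout_le_of_stationary`).

The weights do depend on time, and three devices deal with this. Away from the origin
(`Tout_le_of_mass`), the part of the weight in `|y| ≤ |x|/2` enters only through its mass, because
the kernel there is comparable to its value at `x`. This produces `mass · |x|^(2s-n)`; the part
beyond `|x|/2` is controlled by its pointwise decay. Near the origin (`Tout_le_of_doubling`), the
length scales of the towers `j ≥ 2` shrink as time grows, so no single truncation radius serves for
all later times. Up to `l = 2t` all scales are comparable to those at `t`. After that the kernel is
`O(l^(-n/(2s)))`, integrable since `n > 2s`, and the mass alone matters. For `ω_3` beyond the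
parabolic scale `t^(1/(2s))`, each time slice of the potential is `O(|x|^(2s-n))`, and the decay of
the weight in time supplies convergence (`Tout_le_of_time_decay`).

Since each `μ_{0,j}` is a positive multiple of a power of `t`, monotonicity, comparability under
doubling and the cancellations that produce the stated bounds all become arithmetic of exponents
(`IsPow`). That arithmetic uses that `α_j` is nondecreasing, that `n > 6s`, and that `δ(n-4s) < σ`.
Annuli, tails and concentrated cores are the profiles for `j ≥ 2` and for `ω_{2,1}`; the other
weights at `j = 1`, and `ω_3`, combine the basic estimates directly. -/

namespace BubbleTower

/-! ### Integrals of powers of `|y|`, by scaling. -/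

section RadialIntegrals

/-- Change of variables `y = R z` on `ℝⁿ`. -/
lemma lintegral_eq_scale {n : ℕ} {R : ℝ} (hR : 0 < R)
    {F : EuclideanSpace ℝ (Fin n) → ENNReal} (hF : Measurable F) :
    ∫⁻ y, F y = ENNReal.ofReal (R ^ n) * ∫⁻ y, F (R • y) := by
  rw [← lintegral_map hF (measurable_const_smul R), Measure.map_addHaar_smul _ hR.ne',
    lintegral_smul_measure, smul_eq_mul, ← mul_assoc, ← ENNReal.ofReal_mul (by positivity),
    abs_of_pos (by simp; positivity), finrank_euclideanSpace_fin, mul_inv_cancel₀ (by positivity),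
    ENNReal.ofReal_one, one_mul]

/-- `∫_{|y| ≤ R} |y|^{b-n} dy ≤ C R^b`. -/
lemma lintegral_closedBall_rpow_le (n : ℕ) (hn : 1 ≤ n) {b : ℝ} (hb : 0 < b) :
    ∃ C : ℝ, 0 < C ∧ ∀ R : ℝ, 0 < R →
      ∫⁻ y : EuclideanSpace ℝ (Fin n) in {y | ‖y‖ ≤ R}, ENNReal.ofReal (‖y‖ ^ (b - n))
        ≤ ENNReal.ofReal (C * R ^ b) := by
  -- The radius `2` only makes the open ball contain the closed unit ball; every other radius
  -- follows by scaling.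
  have hfin : IntegrableOn (fun y : EuclideanSpace ℝ (Fin n) => ‖y‖ ^ (b - n))
      (Metric.ball 0 2) := by
    refine integrableOn_ball_of_norm_le_rpow (C := 1) (α := n - b) (by simpa using hn)
      (by simpa using hb) ?_ ?_
    · refine ae_of_all _ fun y => ?_
      rw [Real.norm_of_nonneg (by positivity), neg_sub, one_mul]
    · exact (by fun_prop : Measurable _).aestronglyMeasurable
  have hms : ∀ R : ℝ, MeasurableSet {y : EuclideanSpace ℝ (Fin n) | ‖y‖ ≤ R} := fun R =>
    measurableSet_le measurable_norm measurable_const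
  have hlt : ∫⁻ y : EuclideanSpace ℝ (Fin n) in {y | ‖y‖ ≤ 1}, ENNReal.ofReal (‖y‖ ^ (b - n))
      ≠ ⊤ := by
    refine ne_top_of_le_ne_top hfin.lintegral_lt_top.ne (lintegral_mono_set fun y hy => ?_)
    simp only [mem_ofPred_eq, Metric.mem_ball, dist_zero_right] at *
    linarith
  set I := ∫⁻ y : EuclideanSpace ℝ (Fin n) in {y | ‖y‖ ≤ 1}, ENNReal.ofReal (‖y‖ ^ (b - n))
  -- The `+ 1` makes the constant positive without evaluating `I`.
  refine ⟨I.toReal + 1, by positivity, fun R hR => ?_⟩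
  rw [← lintegral_indicator (hms R), lintegral_eq_scale hR
    ((by fun_prop : Measurable fun y : EuclideanSpace ℝ (Fin n) =>
      ENNReal.ofReal (‖y‖ ^ (b - n))).indicator (hms R))]
  have : ∀ y : EuclideanSpace ℝ (Fin n),
      ({y : EuclideanSpace ℝ (Fin n) | ‖y‖ ≤ R}.indicator
        (fun y => ENNReal.ofReal (‖y‖ ^ (b - n)))) (R • y)
      = ENNReal.ofReal (R ^ (b - n)) * ({y : EuclideanSpace ℝ (Fin n) | ‖y‖ ≤ 1}.indicator
        (fun y => ENNReal.ofReal (‖y‖ ^ (b - n)))) y := by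
    intro y
    have h1 : ‖R • y‖ = R * ‖y‖ := by rw [norm_smul, Real.norm_of_nonneg hR.le]
    have h2 : R * ‖y‖ ≤ R ↔ ‖y‖ ≤ 1 := by
      constructor <;> intro h <;> nlinarith [norm_nonneg y]
    simp only [indicator_apply, mem_ofPred_eq, h1, h2]
    split_ifs
    · rw [← ENNReal.ofReal_mul (by positivity), Real.mul_rpow hR.le (norm_nonneg y)]
    · simp
  simp_rw [this]
  rw [lintegral_const_mul' _ _ ENNReal.ofReal_ne_top, lintegral_indicator (hms 1), ← mul_assoc,
    ← ENNReal.ofReal_mul (by positivity), ← Real.rpow_natCast, ← Real.rpow_add hR,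
    add_sub_cancel, mul_comm]
  change I * _ ≤ _
  rw [ENNReal.ofReal_mul (by positivity)]
  gcongr
  rw [← ENNReal.ofReal_toReal hlt]
  exact ENNReal.ofReal_le_ofReal (by simp)

/-- `∫ max(R,|y|)^{-n-b} dy ≤ C R^{-b}`. -/
lemma lintegral_max_rpow_le (n : ℕ) {b : ℝ} (hb : 0 < b) :
    ∃ C : ℝ, 0 < C ∧ ∀ R : ℝ, 0 < R →
      ∫⁻ y : EuclideanSpace ℝ (Fin n), ENNReal.ofReal (max R ‖y‖ ^ (-n - b))
        ≤ ENNReal.ofReal (C * R ^ (-b)) := by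
  have hfin := finite_integral_one_add_norm (μ := (volume : Measure (EuclideanSpace ℝ (Fin n))))
    (r := n + b) (by simpa using hb)
  have hlt : ∫⁻ y : EuclideanSpace ℝ (Fin n), ENNReal.ofReal (max 1 ‖y‖ ^ (-n - b)) ≠ ⊤ := by
    have hle : ∀ y : EuclideanSpace ℝ (Fin n), ENNReal.ofReal (max 1 ‖y‖ ^ (-n - b))
        ≤ ENNReal.ofReal (2 ^ (n + b)) * ENNReal.ofReal ((1 + ‖y‖) ^ (-(n + b))) := by
      intro y
      rw [← ENNReal.ofReal_mul (by positivity)]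
      refine ENNReal.ofReal_le_ofReal ?_
      have h1 : (1 + ‖y‖) / 2 ≤ max 1 ‖y‖ := by
        rcases le_total 1 ‖y‖ with h | h
        · rw [max_eq_right h]; linarith
        · rw [max_eq_left h]; linarith
      have h2 : max 1 ‖y‖ ^ (-n - b) ≤ ((1 + ‖y‖) / 2) ^ (-n - b) :=
        Real.rpow_le_rpow_of_nonpos (by positivity) h1
          (by have : (0 : ℝ) ≤ n := by positivity
              linarith)
      refine h2.trans_eq ?_
      rw [Real.div_rpow (by positivity) (by positivity), ← neg_add', div_eq_mul_inv,
        ← Real.rpow_neg (by positivity), neg_neg, mul_comm]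
    refine ne_top_of_le_ne_top ?_ (lintegral_mono hle)
    rw [lintegral_const_mul' _ _ ENNReal.ofReal_ne_top]
    exact ENNReal.mul_ne_top ENNReal.ofReal_ne_top hfin.ne
  set I := ∫⁻ y : EuclideanSpace ℝ (Fin n), ENNReal.ofReal (max 1 ‖y‖ ^ (-n - b))
  refine ⟨I.toReal + 1, by positivity, fun R hR => ?_⟩
  rw [lintegral_eq_scale hR (by fun_prop)]
  have : ∀ y : EuclideanSpace ℝ (Fin n), ENNReal.ofReal (max R ‖R • y‖ ^ (-n - b))
      = ENNReal.ofReal (R ^ (-n - b)) * ENNReal.ofReal (max 1 ‖y‖ ^ (-n - b)) := by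
    intro y
    rw [← ENNReal.ofReal_mul (by positivity), ← Real.mul_rpow hR.le (by positivity),
      mul_max_of_nonneg _ _ hR.le, mul_one, norm_smul, Real.norm_of_nonneg hR.le]
  simp_rw [this]
  rw [lintegral_const_mul' _ _ ENNReal.ofReal_ne_top, ← mul_assoc,
    ← ENNReal.ofReal_mul (by positivity), ← Real.rpow_natCast, ← Real.rpow_add hR,
    mul_comm]
  change I * _ ≤ _
  rw [ENNReal.ofReal_mul (by positivity)]
  have hexp : (n : ℝ) + (-n - b) = -b := by ring
  rw [hexp]
  gcongr
  rw [← ENNReal.ofReal_toReal hlt]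
  exact ENNReal.ofReal_le_ofReal (by simp)

end RadialIntegrals

/-! ### Pointwise and integral bounds for the kernel. -/

section Kernel

lemma heatKernel_nonneg (n : ℕ) (s : ℝ) (x : EuclideanSpace ℝ (Fin n)) {t : ℝ} (ht : 0 ≤ t) :
    0 ≤ heatKernel n s x t := by
  unfold heatKernel; positivity

lemma measurable_heatKernel (n : ℕ) (s : ℝ) :
    Measurable fun p : EuclideanSpace ℝ (Fin n) × ℝ => heatKernel n s p.1 p.2 := by
  unfold heatKernel; fun_prop

/-- Harnack-type comparison of the kernel at nearby points. -/
lemma heatKernel_sub_le (n : ℕ) {s : ℝ} (hs : 0 < s) {x y : EuclideanSpace ℝ (Fin n)}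
    (hxy : ‖y‖ ≤ ‖x‖ / 2) {t : ℝ} (ht : 0 < t) :
    heatKernel n s (x - y) t ≤ 4 ^ (((n : ℝ) + 2 * s) / 2) * heatKernel n s x t := by
  unfold heatKernel
  have h1 : ‖x‖ / 2 ≤ ‖x - y‖ := by
    have := norm_sub_norm_le x y
    linarith
  have h0 : 0 < t ^ (1 / s) := by positivity
  have h2 : (t ^ (1 / s) + ‖x‖ ^ 2) / 4 ≤ t ^ (1 / s) + ‖x - y‖ ^ 2 := by
    nlinarith [norm_nonneg x]
  have h3 : ((t ^ (1 / s) + ‖x‖ ^ 2) / 4) ^ (((n : ℝ) + 2 * s) / 2)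
      ≤ (t ^ (1 / s) + ‖x - y‖ ^ 2) ^ (((n : ℝ) + 2 * s) / 2) :=
    Real.rpow_le_rpow (by positivity) h2 (by positivity)
  rw [Real.div_rpow (by positivity) (by positivity)] at h3
  have h4 : (0 : ℝ) < 4 ^ (((n : ℝ) + 2 * s) / 2) := by positivity
  rw [← mul_div_assoc, div_le_div_iff₀ (by positivity) (by positivity)]
  rw [div_le_iff₀ h4] at h3
  nlinarith

/-- The kernel is bounded by `τ max(τ^{1/2s}, |x|)^{-n-2s}`. -/
lemma heatKernel_le_max (n : ℕ) {s : ℝ} (hs : 0 < s) (x : EuclideanSpace ℝ (Fin n)) {t : ℝ}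
    (ht : 0 < t) :
    heatKernel n s x t ≤ t * max (t ^ (1 / (2 * s))) ‖x‖ ^ (-(n : ℝ) - 2 * s) := by
  unfold heatKernel
  have h0 : 0 < t ^ (1 / (2 * s)) := by positivity
  have hsq : t ^ (1 / s) = (t ^ (1 / (2 * s))) ^ 2 := by
    rw [← Real.rpow_natCast, ← Real.rpow_mul ht.le]
    congr 1
    push_cast
    field_simp
  set r := t ^ (1 / (2 * s))
  have h1 : max r ‖x‖ ^ 2 ≤ t ^ (1 / s) + ‖x‖ ^ 2 := by
    rw [hsq]
    rcases le_total r ‖x‖ with h | h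
    · rw [max_eq_right h]; nlinarith
    · rw [max_eq_left h]; nlinarith [norm_nonneg x]
  have hm : 0 < max r ‖x‖ := lt_max_of_lt_left h0
  have h2 : (max r ‖x‖ ^ 2) ^ (((n : ℝ) + 2 * s) / 2)
      ≤ (t ^ (1 / s) + ‖x‖ ^ 2) ^ (((n : ℝ) + 2 * s) / 2) :=
    Real.rpow_le_rpow (by positivity) h1 (by positivity)
  have h3 : (max r ‖x‖ ^ 2) ^ (((n : ℝ) + 2 * s) / 2) = max r ‖x‖ ^ ((n : ℝ) + 2 * s) := by
    rw [← Real.rpow_natCast, ← Real.rpow_mul hm.le]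
    congr 1
    push_cast
    ring
  rw [h3] at h2
  rw [← neg_add', Real.rpow_neg hm.le, ← div_eq_mul_inv]
  gcongr

lemma heatKernel_le_time (n : ℕ) {s : ℝ} (hs : 0 < s) (x : EuclideanSpace ℝ (Fin n)) {t : ℝ}
    (ht : 0 < t) : heatKernel n s x t ≤ t ^ (-(n : ℝ) / (2 * s)) := by
  refine (heatKernel_le_max n hs x ht).trans ?_
  have h1 : max (t ^ (1 / (2 * s))) ‖x‖ ^ (-(n : ℝ) - 2 * s)
      ≤ (t ^ (1 / (2 * s))) ^ (-(n : ℝ) - 2 * s) :=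
    Real.rpow_le_rpow_of_nonpos (by positivity) (le_max_left _ _)
      (by have : (0 : ℝ) ≤ n := by positivity
          linarith)
  rw [← Real.rpow_mul ht.le] at h1
  calc _ ≤ t ^ (1 : ℝ) * t ^ (1 / (2 * s) * (-(n : ℝ) - 2 * s)) := by
        rw [Real.rpow_one]; gcongr
    _ = t ^ (-(n : ℝ) / (2 * s)) := by
        rw [← Real.rpow_add ht]
        congr 1
        field_simp
        ring

lemma heatKernel_le_space (n : ℕ) {s : ℝ} (hs : 0 < s) {x : EuclideanSpace ℝ (Fin n)}
    (hx : x ≠ 0) {t : ℝ} (ht : 0 < t) :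
    heatKernel n s x t ≤ t * ‖x‖ ^ (-(n : ℝ) - 2 * s) := by
  refine (heatKernel_le_max n hs x ht).trans ?_
  gcongr t * ?_
  exact Real.rpow_le_rpow_of_nonpos (by positivity) (le_max_right _ _)
      (by have : (0 : ℝ) ≤ n := by positivity
          linarith)

/-- The space bound increases in `t`, the time bound decreases, and both equal `|x|^(-n)` at the
crossover `t = |x|^(2s)`. -/
lemma heatKernel_le_norm (n : ℕ) {s : ℝ} (hs : 0 < s) {x : EuclideanSpace ℝ (Fin n)}
    (hx : x ≠ 0) {t : ℝ} (ht : 0 < t) :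
    heatKernel n s x t ≤ ‖x‖ ^ (-(n : ℝ)) := by
  have hx0 : 0 < ‖x‖ := norm_pos_iff.2 hx
  rcases le_total t (‖x‖ ^ (2 * s)) with h | h
  · refine (heatKernel_le_space n hs hx ht).trans ?_
    calc _ ≤ ‖x‖ ^ (2 * s) * ‖x‖ ^ (-(n : ℝ) - 2 * s) := by gcongr
      _ = _ := by rw [← Real.rpow_add hx0]; congr 1; ring
  · refine (heatKernel_le_time n hs x ht).trans ?_
    calc t ^ (-(n : ℝ) / (2 * s)) ≤ (‖x‖ ^ (2 * s)) ^ (-(n : ℝ) / (2 * s)) :=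
        Real.rpow_le_rpow_of_nonpos (by positivity) h (div_nonpos_of_nonpos_of_nonneg
          (by simp) (by positivity))
      _ = _ := by rw [← Real.rpow_mul hx0.le]; congr 1; field_simp

/-- `∫ K(z,τ) dz ≤ C` uniformly in `τ`. -/
lemma lintegral_heatKernel_space_le (n : ℕ) {s : ℝ} (hs : 0 < s) :
    ∃ C : ℝ, 0 < C ∧ ∀ (x : EuclideanSpace ℝ (Fin n)) (t : ℝ), 0 < t →
      ∫⁻ y, ENNReal.ofReal (heatKernel n s (x - y) t) ≤ ENNReal.ofReal C := by
  obtain ⟨C, hC, h⟩ := lintegral_max_rpow_le n (b := 2 * s) (by positivity)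
  refine ⟨C, hC, fun x t ht => ?_⟩
  rw [lintegral_sub_left_eq_self (fun y => ENNReal.ofReal (heatKernel n s y t)) x]
  calc _ ≤ ∫⁻ y : EuclideanSpace ℝ (Fin n), ENNReal.ofReal t *
        ENNReal.ofReal (max (t ^ (1 / (2 * s))) ‖y‖ ^ (-(n : ℝ) - 2 * s)) := by
        refine lintegral_mono fun y => ?_
        rw [← ENNReal.ofReal_mul ht.le]
        exact ENNReal.ofReal_le_ofReal (heatKernel_le_max n hs y ht)
    _ ≤ ENNReal.ofReal t * ENNReal.ofReal (C * (t ^ (1 / (2 * s))) ^ (-(2 * s))) := by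
        rw [lintegral_const_mul' _ _ ENNReal.ofReal_ne_top]
        gcongr
        exact h _ (by positivity)
    _ = ENNReal.ofReal C := by
        rw [← ENNReal.ofReal_mul ht.le, ← Real.rpow_mul ht.le]
        congr 1
        have : 1 / (2 * s) * -(2 * s) = -1 := by field_simp
        rw [this, Real.rpow_neg_one]
        field_simp

lemma lintegral_Ioi_rpow {a c : ℝ} (ha : a < -1) (hc : 0 < c) :
    ∫⁻ l in Ioi c, ENNReal.ofReal (l ^ a) = ENNReal.ofReal (-c ^ (a + 1) / (a + 1)) := by
  rw [← integral_Ioi_rpow_of_lt ha hc, ofReal_integral_eq_lintegral_ofReal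
    (integrableOn_Ioi_rpow_of_lt ha hc)]
  filter_upwards [ae_restrict_mem measurableSet_Ioi] with l hl
  have : 0 < l := hc.trans hl
  positivity

/-- `∫₀^∞ K(z,τ) dτ ≤ C |z|^{2s-n}`. -/
lemma lintegral_heatKernel_time_le (n : ℕ) {s : ℝ} (hs : 0 < s) (hn : 2 * s < n) :
    ∃ C : ℝ, 0 < C ∧ ∀ (z : EuclideanSpace ℝ (Fin n)) (t : ℝ), z ≠ 0 →
      ∫⁻ l in Ioi t, ENNReal.ofReal (heatKernel n s z (l - t))
        ≤ ENNReal.ofReal (C * ‖z‖ ^ (2 * s - n)) := by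
  have hq : -(n : ℝ) / (2 * s) < -1 := by
    rw [div_lt_iff₀ (by positivity)]; linarith
  set q := -(n : ℝ) / (2 * s) with hqdef
  refine ⟨1 + 1 / (-(q + 1)), by
    have : 0 < -(q + 1) := by linarith
    positivity, fun z t hz => ?_⟩
  have hz0 : 0 < ‖z‖ := norm_pos_iff.2 hz
  have hshift : ∫⁻ l in Ioi t, ENNReal.ofReal (heatKernel n s z (l - t))
      = ∫⁻ l in Ioi 0, ENNReal.ofReal (heatKernel n s z l) := by
    rw [← lintegral_indicator measurableSet_Ioi, ← lintegral_indicator measurableSet_Ioi,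
      ← lintegral_sub_right_eq_self ((Ioi 0).indicator _) t]
    refine lintegral_congr fun l => ?_
    simp [indicator_apply]
  rw [hshift]
  -- Crossover time: before `T` the kernel is at most `|z|^(-n)` over a length `|z|^(2s)`; after it,
  -- the tail of `l^q` is integrated. Both pieces are of order `|z|^(2s-n)`.
  set T := ‖z‖ ^ (2 * s) with hT
  have hT0 : 0 < T := by positivity
  rw [← Ioc_union_Ioi_eq_Ioi hT0.le]
  refine (lintegral_union_le _ _ _).trans ?_
  have hA : ∫⁻ l in Ioc 0 T, ENNReal.ofReal (heatKernel n s z l)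
      ≤ ENNReal.ofReal (‖z‖ ^ (2 * s - n)) := by
    calc _ ≤ ∫⁻ l in Ioc 0 T, ENNReal.ofReal (‖z‖ ^ (-(n : ℝ))) := by
          refine setLIntegral_mono measurable_const fun l hl => ?_
          exact ENNReal.ofReal_le_ofReal (heatKernel_le_norm n hs hz hl.1)
      _ = _ := by
          rw [setLIntegral_const, Real.volume_Ioc, sub_zero, ← ENNReal.ofReal_mul (by positivity),
            hT, ← Real.rpow_add hz0]
          congr 2
          ring
  have hB : ∫⁻ l in Ioi T, ENNReal.ofReal (heatKernel n s z l)
      ≤ ENNReal.ofReal (1 / (-(q + 1)) * ‖z‖ ^ (2 * s - n)) := by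
    calc _ ≤ ∫⁻ l in Ioi T, ENNReal.ofReal (l ^ q) := by
          refine setLIntegral_mono (by fun_prop) fun l hl => ?_
          exact ENNReal.ofReal_le_ofReal (heatKernel_le_time n hs z (hT0.trans hl))
      _ = _ := by
          rw [lintegral_Ioi_rpow hq hT0, hT, ← Real.rpow_mul hz0.le]
          have : 2 * s * (q + 1) = 2 * s - n := by rw [hqdef]; field_simp; ring
          rw [this]
          congr 1
          have : q + 1 ≠ 0 := by linarith
          field_simp
  refine (add_le_add hA hB).trans ?_
  have : 0 < -(q + 1) := by linarith
  rw [← ENNReal.ofReal_add (by positivity) (by positivity)]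
  exact ENNReal.ofReal_le_ofReal (by linarith)

end Kernel

/-! ### Riesz potentials of truncated powers. -/

section Riesz

/-- Riesz potential of the truncated power `max(R,|y|)^{-a}`. -/
lemma lintegral_riesz_max_le (n : ℕ) (hn1 : 1 ≤ n) {s a : ℝ} (hs : 0 < s) (hn : 2 * s < n)
    (ha : 2 * s < a) :
    ∃ C : ℝ, 0 < C ∧ ∀ (x : EuclideanSpace ℝ (Fin n)) (R : ℝ), 0 < R →
      ∫⁻ y, ENNReal.ofReal (‖x - y‖ ^ (2 * s - n) * max R ‖y‖ ^ (-a))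
        ≤ ENNReal.ofReal (C * R ^ (2 * s - a)) := by
  obtain ⟨C₁, hC₁, h₁⟩ := lintegral_closedBall_rpow_le n hn1 (b := 2 * s) (by positivity)
  obtain ⟨C₂, hC₂, h₂⟩ := lintegral_max_rpow_le n (b := a - 2 * s) (by linarith)
  refine ⟨C₁ + C₂ + C₂, by positivity, fun x R hR => ?_⟩
  have hms : MeasurableSet {y : EuclideanSpace ℝ (Fin n) | ‖y‖ ≤ R} :=
    measurableSet_le measurable_norm measurable_const
  let f₁ : EuclideanSpace ℝ (Fin n) → ENNReal := fun z => ENNReal.ofReal (R ^ (-a)) *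
    {y : EuclideanSpace ℝ (Fin n) | ‖y‖ ≤ R}.indicator (fun z => ENNReal.ofReal (‖z‖ ^ (2 * s - n))) z
  let f₂ : EuclideanSpace ℝ (Fin n) → ENNReal := fun z =>
    ENNReal.ofReal (max R ‖z‖ ^ (-(n : ℝ) - (a - 2 * s)))
  have hf₁ : Measurable f₁ := ((by fun_prop :
    Measurable fun z : EuclideanSpace ℝ (Fin n) => ENNReal.ofReal (‖z‖ ^ (2 * s - n))).indicator
      hms).const_mul _
  have hf₂ : Measurable f₂ := by fun_prop
  -- With `z = x - y`: if `|z| ≤ R`, keep the Riesz singularity and bound the weight by `R^(-a)`; if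
  -- `R ≤ |z| ≤ max R |y|`, both factors become powers of `|z|`; otherwise both become powers of
  -- `max R |y|`. The last two give the total exponent `-n - (a - 2s)`, integrable because `a > 2s`.
  have hpt : ∀ y, ENNReal.ofReal (‖x - y‖ ^ (2 * s - n) * max R ‖y‖ ^ (-a))
      ≤ f₁ (x - y) + f₂ (x - y) + f₂ y := by
    intro y
    set z := x - y
    have hm : 0 < max R ‖y‖ := lt_max_of_lt_left hR
    rcases le_total ‖z‖ R with h | h
    · have : f₁ z = ENNReal.ofReal (R ^ (-a) * ‖z‖ ^ (2 * s - n)) := by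
        simp only [f₁]
        rw [indicator_of_mem (by simpa using h), ENNReal.ofReal_mul (by positivity)]
      rw [this, add_assoc]
      refine le_add_right (ENNReal.ofReal_le_ofReal ?_)
      rw [mul_comm]
      gcongr ?_ * ?_
      exact Real.rpow_le_rpow_of_nonpos hR (le_max_left _ _) (by linarith)
    have hz : 0 < ‖z‖ := hR.trans_le h
    rcases le_total ‖z‖ (max R ‖y‖) with h' | h'
    · rw [add_right_comm]
      refine le_add_left (ENNReal.ofReal_le_ofReal ?_)
      rw [max_eq_right h]
      calc _ ≤ ‖z‖ ^ (2 * s - n) * ‖z‖ ^ (-a) := by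
            gcongr ?_ * ?_
            exact Real.rpow_le_rpow_of_nonpos hz h' (by linarith)
        _ = _ := by rw [← Real.rpow_add hz]; congr 1; ring
    · refine le_add_left (ENNReal.ofReal_le_ofReal ?_)
      calc _ ≤ max R ‖y‖ ^ (2 * s - n) * max R ‖y‖ ^ (-a) := by
            gcongr ?_ * ?_
            exact Real.rpow_le_rpow_of_nonpos hm h' (by linarith)
        _ = _ := by rw [← Real.rpow_add hm]; congr 1; ring
  refine (lintegral_mono hpt).trans ?_
  rw [lintegral_add_right _ hf₂, lintegral_add_right _ (by fun_prop),
    lintegral_sub_left_eq_self f₁ x, lintegral_sub_left_eq_self f₂ x]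
  have e₁ : ∫⁻ z, f₁ z ≤ ENNReal.ofReal (C₁ * R ^ (2 * s - a)) := by
    simp only [f₁]
    rw [lintegral_const_mul' _ _ ENNReal.ofReal_ne_top, lintegral_indicator hms]
    calc _ ≤ ENNReal.ofReal (R ^ (-a)) * ENNReal.ofReal (C₁ * R ^ (2 * s)) := by
          gcongr; exact h₁ R hR
      _ = _ := by
          rw [← ENNReal.ofReal_mul (by positivity), mul_left_comm, ← Real.rpow_add hR]
          congr 3; ring
  have e₂ : ∫⁻ z, f₂ z ≤ ENNReal.ofReal (C₂ * R ^ (2 * s - a)) := by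
    refine (h₂ R hR).trans_eq ?_
    congr 3; ring
  refine (add_le_add (add_le_add e₁ e₂) e₂).trans_eq ?_
  rw [← ENNReal.ofReal_add (by positivity) (by positivity),
    ← ENNReal.ofReal_add (by positivity) (by positivity)]
  congr 1; ring

end Riesz

/-! ### Basic estimates for the Duhamel operator. -/

section Operator

/-- Potential of a time-independent truncated power. -/
lemma lintegral_heatKernel_max_le (n : ℕ) (hn1 : 1 ≤ n) {s a : ℝ} (hs : 0 < s) (hn : 2 * s < n)
    (ha : 2 * s < a) :
    ∃ C : ℝ, 0 < C ∧ ∀ (x : EuclideanSpace ℝ (Fin n)) (t R A : ℝ), 0 < R → 0 ≤ A →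
      ∫⁻ l in Ioi t, ∫⁻ y, ENNReal.ofReal (heatKernel n s (x - y) (l - t)) *
          ENNReal.ofReal (A * max R ‖y‖ ^ (-a))
        ≤ ENNReal.ofReal (C * (A * R ^ (2 * s - a))) := by
  obtain ⟨C₁, hC₁, h₁⟩ := lintegral_heatKernel_time_le n hs hn
  obtain ⟨C₂, hC₂, h₂⟩ := lintegral_riesz_max_le n hn1 hs hn ha
  refine ⟨C₁ * C₂, by positivity, fun x t R A hR hA => ?_⟩
  have hm : Measurable fun p : ℝ × EuclideanSpace ℝ (Fin n) =>
      ENNReal.ofReal (heatKernel n s (x - p.2) (p.1 - t)) *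
          ENNReal.ofReal (A * max R ‖p.2‖ ^ (-a)) := by
    refine Measurable.mul (Measurable.ennreal_ofReal ?_) (by fun_prop)
    exact (measurable_heatKernel n s).comp
      (f := fun p : ℝ × EuclideanSpace ℝ (Fin n) => (x - p.2, p.1 - t)) (by fun_prop)
  -- Integrating in time first replaces the kernel by the Riesz kernel.
  rw [lintegral_lintegral_swap hm.aemeasurable]
  -- At `y = x` the time integral diverges, while `0 ^ (2 * s - n)` is `0` by convention; this point
  -- has measure zero because `n ≥ 1`.
  have hne : ∀ᵐ y : EuclideanSpace ℝ (Fin n), y ≠ x := by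
    have : Nontrivial (EuclideanSpace ℝ (Fin n)) :=
      Module.nontrivial_of_finrank_pos (R := ℝ) (by simp; omega)
    exact Measure.ae_ne _ x
  calc _ ≤ ∫⁻ y, ENNReal.ofReal (C₁ * A) *
        ENNReal.ofReal (‖x - y‖ ^ (2 * s - n) * max R ‖y‖ ^ (-a)) := by
        refine lintegral_mono_ae ?_
        filter_upwards [hne] with y hy
        rw [lintegral_mul_const' _ _ ENNReal.ofReal_ne_top]
        refine (mul_le_mul_left (h₁ (x - y) t (sub_ne_zero.2 hy.symm)) _).trans_eq ?_
        rw [← ENNReal.ofReal_mul (by positivity), ← ENNReal.ofReal_mul (by positivity)]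
        congr 1; ring
    _ ≤ ENNReal.ofReal (C₁ * A) * ENNReal.ofReal (C₂ * R ^ (2 * s - a)) := by
        rw [lintegral_const_mul' _ _ ENNReal.ofReal_ne_top]
        gcongr
        exact h₂ x R hR
    _ = _ := by
        rw [← ENNReal.ofReal_mul (by positivity)]
        congr 1; ring

/-- Splitting off a time-independent measurable majorant. -/
lemma Tout_le_add (n : ℕ) (s : ℝ) {G : EuclideanSpace ℝ (Fin n) → ℝ → ℝ}
    {F : EuclideanSpace ℝ (Fin n) → ℝ → ENNReal} {g : EuclideanSpace ℝ (Fin n) → ENNReal}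
    (hg : Measurable g) (x : EuclideanSpace ℝ (Fin n)) (t : ℝ)
    (h : ∀ l, t < l → ∀ y, ENNReal.ofReal |G y l| ≤ F y l + g y) :
    Tout n s G x t ≤
      (∫⁻ l in Ioi t, ∫⁻ y, ENNReal.ofReal (heatKernel n s (x - y) (l - t)) * F y l)
      + ∫⁻ l in Ioi t, ∫⁻ y, ENNReal.ofReal (heatKernel n s (x - y) (l - t)) * g y := by
  have hm : Measurable fun p : ℝ × EuclideanSpace ℝ (Fin n) =>
      ENNReal.ofReal (heatKernel n s (x - p.2) (p.1 - t)) * g p.2 := by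
    refine Measurable.mul (Measurable.ennreal_ofReal ?_) (by fun_prop)
    exact (measurable_heatKernel n s).comp
      (f := fun p : ℝ × EuclideanSpace ℝ (Fin n) => (x - p.2, p.1 - t)) (by fun_prop)
  -- Additivity needs measurability of the second summand only, so nothing is asked of `F` or `G`,
  -- and the weights never have to be shown measurable.
  rw [← lintegral_add_right _ hm.lintegral_prod_right']
  refine setLIntegral_mono' measurableSet_Ioi fun l hl => ?_
  have hm' : Measurable fun y : EuclideanSpace ℝ (Fin n) =>
      ENNReal.ofReal (heatKernel n s (x - y) (l - t)) * g y := hm.comp measurable_prodMk_left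
  rw [← lintegral_add_right _ hm']
  refine lintegral_mono fun y => ?_
  rw [ENNReal.ofReal_mul (heatKernel_nonneg n s _ (sub_nonneg.2 (le_of_lt hl)))]
  rw [← mul_add]
  gcongr
  exact h l hl y

/-- Weights dominated by a time-independent truncated power. -/
lemma Tout_le_of_stationary (n : ℕ) (hn1 : 1 ≤ n) {s a : ℝ} (hs : 0 < s) (hn : 2 * s < n)
    (ha : 2 * s < a) :
    ∃ C : ℝ, 0 < C ∧ ∀ (G : EuclideanSpace ℝ (Fin n) → ℝ → ℝ) (x : EuclideanSpace ℝ (Fin n))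
      (t R A : ℝ), 0 < R → 0 ≤ A →
      (∀ l, t < l → ∀ y, |G y l| ≤ A * max R ‖y‖ ^ (-a)) →
      Tout n s G x t ≤ ENNReal.ofReal (C * (A * R ^ (2 * s - a))) := by
  obtain ⟨C, hC, h⟩ := lintegral_heatKernel_max_le n hn1 hs hn ha
  refine ⟨C, hC, fun G x t R A hR hA hG => ?_⟩
  refine (Tout_le_add n s (F := fun _ _ => 0)
    (g := fun y => ENNReal.ofReal (A * max R ‖y‖ ^ (-a))) (by fun_prop) x t
    fun l hl y => ?_).trans ?_
  · rw [zero_add]; exact ENNReal.ofReal_le_ofReal (hG l hl y)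
  · simpa using h x t R A hR hA

/-- Away from the origin: the part of the weight in `|y| ≤ |x|/2` contributes through its mass,
the outer part through its pointwise decay. -/
lemma Tout_le_of_mass (n : ℕ) (hn1 : 1 ≤ n) {s a : ℝ} (hs : 0 < s) (hn : 2 * s < n)
    (ha : 2 * s < a) :
    ∃ C : ℝ, 0 < C ∧ ∀ (G : EuclideanSpace ℝ (Fin n) → ℝ → ℝ) (x : EuclideanSpace ℝ (Fin n))
      (t M A : ℝ), x ≠ 0 → 0 ≤ M → 0 ≤ A →
      (∀ l, t < l → ∀ y, ‖x‖ / 2 ≤ ‖y‖ → |G y l| ≤ A * ‖y‖ ^ (-a)) →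
      (∀ l, t < l → ∫⁻ y in {y | ‖y‖ ≤ ‖x‖ / 2}, ENNReal.ofReal |G y l| ≤ ENNReal.ofReal M) →
      Tout n s G x t
        ≤ ENNReal.ofReal (C * (M * ‖x‖ ^ (2 * s - n) + A * ‖x‖ ^ (2 * s - a))) := by
  obtain ⟨C₁, hC₁, h₁⟩ := lintegral_heatKernel_max_le n hn1 hs hn ha
  obtain ⟨C₂, hC₂, h₂⟩ := lintegral_heatKernel_time_le n hs hn
  set c : ℝ := 4 ^ (((n : ℝ) + 2 * s) / 2) with hc
  have hc0 : 0 < c := by positivity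
  set d : ℝ := (1 / 2) ^ (2 * s - a) with hd
  have hd0 : 0 < d := by positivity
  refine ⟨c * C₂ + C₁ * d, by positivity, fun G x t M A hx hM hA hG hmass => ?_⟩
  have hx0 : 0 < ‖x‖ := norm_pos_iff.2 hx
  have hms : MeasurableSet {y : EuclideanSpace ℝ (Fin n) | ‖y‖ ≤ ‖x‖ / 2} :=
    measurableSet_le measurable_norm measurable_const
  -- `F` is the weight inside `|y| ≤ |x|/2`; outside, the power `|y|^(-a)` is a truncated power with
  -- radius `|x|/2`.
  refine (Tout_le_add n s
    (F := fun y l => {y : EuclideanSpace ℝ (Fin n) | ‖y‖ ≤ ‖x‖ / 2}.indicator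
      (fun y => ENNReal.ofReal |G y l|) y)
    (g := fun y => ENNReal.ofReal (A * max (‖x‖ / 2) ‖y‖ ^ (-a))) (by fun_prop) x t
    fun l hl y => ?_).trans ?_
  · by_cases hy : ‖y‖ ≤ ‖x‖ / 2
    · rw [indicator_of_mem (by simpa using hy)]
      exact le_self_add
    · push Not at hy
      rw [indicator_of_notMem (by simpa using hy), zero_add, max_eq_right hy.le]
      exact ENNReal.ofReal_le_ofReal (hG l hl y hy.le)
  have hin : (∫⁻ l in Ioi t, ∫⁻ y, ENNReal.ofReal (heatKernel n s (x - y) (l - t)) *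
      {y : EuclideanSpace ℝ (Fin n) | ‖y‖ ≤ ‖x‖ / 2}.indicator
        (fun y => ENNReal.ofReal |G y l|) y)
      ≤ ENNReal.ofReal (c * C₂ * (M * ‖x‖ ^ (2 * s - n))) := by
    calc _ ≤ ∫⁻ l in Ioi t, ENNReal.ofReal (heatKernel n s x (l - t)) * ENNReal.ofReal (c * M) := by
          refine setLIntegral_mono' measurableSet_Ioi fun l hl => ?_
          have hl' : 0 < l - t := sub_pos.2 hl
          calc _ ≤ ∫⁻ y, ENNReal.ofReal (c * heatKernel n s x (l - t)) *
                {y : EuclideanSpace ℝ (Fin n) | ‖y‖ ≤ ‖x‖ / 2}.indicator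
                  (fun y => ENNReal.ofReal |G y l|) y := by
                refine lintegral_mono fun y => ?_
                by_cases hy : ‖y‖ ≤ ‖x‖ / 2
                · gcongr
                  exact heatKernel_sub_le n hs hy hl'
                · rw [indicator_of_notMem (by simpa using hy)]; simp
            _ ≤ ENNReal.ofReal (c * heatKernel n s x (l - t)) * ENNReal.ofReal M := by
                rw [lintegral_const_mul' _ _ ENNReal.ofReal_ne_top, lintegral_indicator hms]
                gcongr
                exact hmass l hl
            _ = _ := by
                have := heatKernel_nonneg n s x hl'.le
                rw [← ENNReal.ofReal_mul (by positivity), ← ENNReal.ofReal_mul (by positivity)]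
                congr 1; ring
      _ ≤ ENNReal.ofReal (C₂ * ‖x‖ ^ (2 * s - n)) * ENNReal.ofReal (c * M) := by
          rw [lintegral_mul_const' _ _ ENNReal.ofReal_ne_top]
          gcongr
          exact h₂ x t hx
      _ = _ := by
          rw [← ENNReal.ofReal_mul (by positivity)]
          congr 1; ring
  refine (add_le_add hin (h₁ x t (‖x‖ / 2) A (by positivity) hA)).trans ?_
  rw [← ENNReal.ofReal_add (by positivity) (by positivity)]
  refine ENNReal.ofReal_le_ofReal ?_
  have : (‖x‖ / 2) ^ (2 * s - a) = d * ‖x‖ ^ (2 * s - a) := by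
    rw [hd, ← Real.mul_rpow (by positivity) (by positivity)]
    congr 1; ring
  rw [this]
  have p1 : 0 ≤ c * C₂ * (A * ‖x‖ ^ (2 * s - a)) := by positivity
  have p2 : 0 ≤ C₁ * d * (M * ‖x‖ ^ (2 * s - n)) := by positivity
  nlinarith

/-- Near the origin: pointwise control for `t < l ≤ 2t` and control of the mass for `l > 2t`. -/
lemma Tout_le_of_doubling (n : ℕ) (hn1 : 1 ≤ n) {s a : ℝ} (hs : 0 < s) (hn : 2 * s < n)
    (ha : 2 * s < a) :
    ∃ C : ℝ, 0 < C ∧ ∀ (G : EuclideanSpace ℝ (Fin n) → ℝ → ℝ) (x : EuclideanSpace ℝ (Fin n))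
      (t R A M : ℝ), 1 ≤ t → 0 < R → 0 ≤ A → 0 ≤ M →
      (∀ l, t < l → l ≤ 2 * t → ∀ y, |G y l| ≤ A * max R ‖y‖ ^ (-a)) →
      (∀ l, 2 * t < l → ∫⁻ y, ENNReal.ofReal |G y l| ≤ ENNReal.ofReal M) →
      Tout n s G x t ≤ ENNReal.ofReal (C * (A * R ^ (2 * s - a) + M)) := by
  obtain ⟨C₁, hC₁, h₁⟩ := lintegral_heatKernel_max_le n hn1 hs hn ha
  have hq : -(n : ℝ) / (2 * s) < -1 := by
    rw [div_lt_iff₀ (by positivity)]; linarith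
  set q := -(n : ℝ) / (2 * s) with hqdef
  have hq1 : 0 < -(q + 1) := by linarith
  set c : ℝ := (1 / 2) ^ q with hc
  have hc0 : 0 < c := by positivity
  refine ⟨C₁ + c * (1 / -(q + 1)), by positivity, fun G x t R A M ht hR hA hM hG hmass => ?_⟩
  refine (Tout_le_add n s
    (F := fun y l => if l ≤ 2 * t then 0 else ENNReal.ofReal |G y l|)
    (g := fun y => ENNReal.ofReal (A * max R ‖y‖ ^ (-a))) (by fun_prop) x t
    fun l hl y => ?_).trans ?_
  · split_ifs with h
    · rw [zero_add]; exact ENNReal.ofReal_le_ofReal (hG l hl h y)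
    · exact le_self_add
  have hin : (∫⁻ l in Ioi t, ∫⁻ y, ENNReal.ofReal (heatKernel n s (x - y) (l - t)) *
      (if l ≤ 2 * t then 0 else ENNReal.ofReal |G y l|))
      ≤ ENNReal.ofReal (c * (1 / -(q + 1)) * M) := by
    calc _ ≤ ∫⁻ l in Ioi t, (Ioi (2 * t)).indicator
            (fun l => ENNReal.ofReal (c * M) * ENNReal.ofReal (l ^ q)) l := by
          refine setLIntegral_mono' measurableSet_Ioi fun l hl => ?_
          have hl' : 0 < l - t := sub_pos.2 hl
          by_cases h : l ≤ 2 * t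
          · simp [h]
          push Not at h
          rw [indicator_of_mem (by simpa using h)]
          simp only [not_le.2 h, if_false]
          have hl0 : 0 < l := by linarith
          -- For `l > 2t` one has `l - t ≥ l/2`; the factor `c` pays for the half.
          have hk : ∀ y, heatKernel n s (x - y) (l - t) ≤ c * l ^ q := by
            intro y
            refine (heatKernel_le_time n hs (x - y) hl').trans ?_
            rw [hc, ← Real.mul_rpow (by positivity) (by positivity)]
            exact Real.rpow_le_rpow_of_nonpos (by positivity) (by linarith) (by linarith)
          calc _ ≤ ∫⁻ y, ENNReal.ofReal (c * l ^ q) * ENNReal.ofReal |G y l| := by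
                refine lintegral_mono fun y => ?_
                gcongr
                exact hk y
            _ ≤ ENNReal.ofReal (c * l ^ q) * ENNReal.ofReal M := by
                rw [lintegral_const_mul' _ _ ENNReal.ofReal_ne_top]
                gcongr
                exact hmass l h
            _ = _ := by
                rw [← ENNReal.ofReal_mul (by positivity), ← ENNReal.ofReal_mul (by positivity)]
                congr 1; ring
      _ ≤ ∫⁻ l, (Ioi (2 * t)).indicator
            (fun l => ENNReal.ofReal (c * M) * ENNReal.ofReal (l ^ q)) l :=
          setLIntegral_le_lintegral _ _
      _ = ENNReal.ofReal (c * M) * ENNReal.ofReal (-(2 * t) ^ (q + 1) / (q + 1)) := by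
          rw [lintegral_indicator measurableSet_Ioi,
            lintegral_const_mul' _ _ ENNReal.ofReal_ne_top,
            lintegral_Ioi_rpow hq (by linarith)]
      _ ≤ _ := by
          rw [← ENNReal.ofReal_mul (by positivity)]
          refine ENNReal.ofReal_le_ofReal ?_
          -- This is where `1 ≤ t` enters: the late tail of the time integral is bounded by a
          -- constant.
          have h2 : (2 * t) ^ (q + 1) ≤ 1 :=
            Real.rpow_le_one_of_one_le_of_nonpos (by linarith) (by linarith)
          have h3 : -(2 * t) ^ (q + 1) / (q + 1) ≤ 1 / -(q + 1) := by
            rw [neg_div, ← div_neg]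
            gcongr
          calc _ ≤ c * M * (1 / -(q + 1)) := by gcongr
            _ = _ := by ring
  refine (add_le_add hin (h₁ x t R A hR hA)).trans ?_
  rw [← ENNReal.ofReal_add (by positivity) (by positivity)]
  refine ENNReal.ofReal_le_ofReal ?_
  have p1 : 0 ≤ c * (1 / -(q + 1)) * (A * R ^ (2 * s - a)) := by positivity
  have p2 : 0 ≤ C₁ * M := by positivity
  nlinarith

end Operator

/-! ### Masses of weights under pointwise bounds. -/

section Mass

lemma ae_ne_zero (n : ℕ) (hn1 : 1 ≤ n) : ∀ᵐ y : EuclideanSpace ℝ (Fin n), y ≠ 0 := by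
  have : Nontrivial (EuclideanSpace ℝ (Fin n)) :=
    Module.nontrivial_of_finrank_pos (R := ℝ) (by simp; omega)
  exact Measure.ae_ne _ 0

lemma measurableSet_norm_le (n : ℕ) (ρ : ℝ) :
    MeasurableSet {y : EuclideanSpace ℝ (Fin n) | ‖y‖ ≤ ρ} :=
  measurableSet_le measurable_norm measurable_const

/-- Mass in a ball of a function bounded by `A |y|^{-c}`, `c < n`. -/
lemma setLIntegral_le_of_le_rpow (n : ℕ) (hn1 : 1 ≤ n) {c : ℝ} (hc : c < n) :
    ∃ C : ℝ, 0 < C ∧ ∀ (g : EuclideanSpace ℝ (Fin n) → ℝ) (ρ A : ℝ), 0 < ρ → 0 ≤ A →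
      (∀ y, y ≠ 0 → |g y| ≤ A * ‖y‖ ^ (-c)) →
      ∫⁻ y in {y | ‖y‖ ≤ ρ}, ENNReal.ofReal |g y| ≤ ENNReal.ofReal (C * (A * ρ ^ (n - c))) := by
  obtain ⟨C, hC, h⟩ := lintegral_closedBall_rpow_le n hn1 (b := n - c) (by linarith)
  refine ⟨C, hC, fun g ρ A hρ hA hg => ?_⟩
  calc _ ≤ ∫⁻ y : EuclideanSpace ℝ (Fin n) in {y | ‖y‖ ≤ ρ},
        ENNReal.ofReal A * ENNReal.ofReal (‖y‖ ^ ((n : ℝ) - c - n)) := by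
        refine lintegral_mono_ae (ae_restrict_of_ae ?_)
        filter_upwards [ae_ne_zero n hn1] with y hy
        rw [← ENNReal.ofReal_mul hA]
        refine ENNReal.ofReal_le_ofReal ((hg y hy).trans_eq ?_)
        congr 2; ring
    _ ≤ ENNReal.ofReal A * ENNReal.ofReal (C * ρ ^ ((n : ℝ) - c)) := by
        rw [lintegral_const_mul' _ _ ENNReal.ofReal_ne_top]
        gcongr
        exact h ρ hρ
    _ = _ := by
        rw [← ENNReal.ofReal_mul hA]
        congr 1; ring

lemma lintegral_eq_of_support (n : ℕ) {g : EuclideanSpace ℝ (Fin n) → ℝ} {ρ : ℝ}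
    (hg : ∀ y, ρ < ‖y‖ → g y = 0) :
    ∫⁻ y, ENNReal.ofReal |g y| = ∫⁻ y in {y | ‖y‖ ≤ ρ}, ENNReal.ofReal |g y| := by
  rw [← lintegral_indicator (measurableSet_norm_le n ρ)]
  refine lintegral_congr fun y => ?_
  by_cases hy : ‖y‖ ≤ ρ
  · rw [indicator_of_mem (by simpa using hy)]
  · rw [indicator_of_notMem (by simpa using hy), hg y (not_le.1 hy)]
    simp

/-- Mass of a function bounded by `A max(R,|y|)^{-n-b}`. -/
lemma lintegral_le_of_le_max (n : ℕ) {b : ℝ} (hb : 0 < b) :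
    ∃ C : ℝ, 0 < C ∧ ∀ (g : EuclideanSpace ℝ (Fin n) → ℝ) (R A : ℝ), 0 < R → 0 ≤ A →
      (∀ y, |g y| ≤ A * max R ‖y‖ ^ (-n - b)) →
      ∫⁻ y, ENNReal.ofReal |g y| ≤ ENNReal.ofReal (C * (A * R ^ (-b))) := by
  obtain ⟨C, hC, h⟩ := lintegral_max_rpow_le n hb
  refine ⟨C, hC, fun g R A hR hA hg => ?_⟩
  calc _ ≤ ∫⁻ y : EuclideanSpace ℝ (Fin n),
        ENNReal.ofReal A * ENNReal.ofReal (max R ‖y‖ ^ (-n - b)) := by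
        refine lintegral_mono fun y => ?_
        rw [← ENNReal.ofReal_mul hA]
        exact ENNReal.ofReal_le_ofReal (hg y)
    _ ≤ ENNReal.ofReal A * ENNReal.ofReal (C * R ^ (-b)) := by
        rw [lintegral_const_mul' _ _ ENNReal.ofReal_ne_top]
        gcongr
        exact h R hR
    _ = _ := by
        rw [← ENNReal.ofReal_mul hA]
        congr 1; ring

end Mass

/-! ### Potentials of annular and tail-shaped weights. -/

section Profiles

/-- Weights comparable to `A |y|^{2s-n}` on an annulus with outer radius `R₂`, whose inner radius
is comparable to `R₁` for `t < l ≤ 2t`. -/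
lemma Tout_annulus_le (n : ℕ) (hn1 : 1 ≤ n) {s D : ℝ} (hs : 0 < s) (hn : 4 * s < n)
    (hD : 0 < D) :
    ∃ C : ℝ, 0 < C ∧ ∀ (G : EuclideanSpace ℝ (Fin n) → ℝ → ℝ) (x : EuclideanSpace ℝ (Fin n))
      (t A R₁ R₂ : ℝ), 1 ≤ t → 0 ≤ A → 0 < R₁ → R₁ ≤ D → 0 < R₂ → R₂ ≤ D →
      (∀ l, t < l → ∀ y, |G y l| ≤ A * ‖y‖ ^ (2 * s - n)) →
      (∀ l, t < l → ∀ y, R₂ < ‖y‖ → G y l = 0) →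
      (∀ l, t < l → l ≤ 2 * t → ∀ y, ‖y‖ < R₁ / D → G y l = 0) →
      Tout n s G x t ≤ ENNReal.ofReal (C * (A * R₁ ^ (4 * s - n))) ∧
      (x ≠ 0 → Tout n s G x t ≤ ENNReal.ofReal (C * (A * ‖x‖ ^ (4 * s - n)))) ∧
      (x ≠ 0 → Tout n s G x t
        ≤ ENNReal.ofReal (C * (A * R₂ ^ (2 * s) * ‖x‖ ^ (2 * s - n)))) := by
  obtain ⟨C₀, hC₀, h₀⟩ := setLIntegral_le_of_le_rpow n hn1 (c := n - 2 * s) (by linarith)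
  obtain ⟨C₁, hC₁, h₁⟩ := Tout_le_of_doubling n hn1 hs (by linarith)
    (show 2 * s < n - 2 * s by linarith)
  obtain ⟨C₂, hC₂, h₂⟩ := Tout_le_of_mass n hn1 hs (by linarith)
    (show 2 * s < n - 2 * s by linarith)
  -- Far from the support the decay rate `n` is the right one: for `|y| ≤ R₂` one has `|y|^(2s-n) ≤
  -- R₂^(2s) |y|^(-n)`, so the pointwise and mass terms have the same size.
  obtain ⟨C₃, hC₃, h₃⟩ := Tout_le_of_mass n hn1 hs (by linarith) (show 2 * s < n by linarith)
  set k₁ := C₁ * (D ^ (n - 4 * s) + C₀ * D ^ (2 * s) * D ^ (n - 4 * s)) with hk₁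
  set k₂ := C₂ * (C₀ * (1 / 2) ^ (2 * s) + 1) with hk₂
  set k₃ := C₃ * (C₀ + 1) with hk₃
  have hk₁' : 0 < k₁ := by positivity
  have hk₂' : 0 < k₂ := by positivity
  have hk₃' : 0 < k₃ := by positivity
  refine ⟨k₁ + k₂ + k₃, by positivity,
    fun G x t A R₁ R₂ ht hA hR₁ hR₁D hR₂ hR₂D hG hG₂ hG₁ => ?_⟩
  have hpow : ∀ l, t < l → ∀ y, |G y l| ≤ A * ‖y‖ ^ (-(n - 2 * s)) := by
    intro l hl y
    rw [neg_sub]; exact hG l hl y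
  have hn2 : (n : ℝ) - (n - 2 * s) = 2 * s := by ring
  have hmass : ∀ l, t < l → ∀ ρ, 0 < ρ → ∫⁻ y in {y | ‖y‖ ≤ ρ}, ENNReal.ofReal |G y l|
      ≤ ENNReal.ofReal (C₀ * (A * ρ ^ (2 * s))) := by
    intro l hl ρ hρ
    have := h₀ (fun y => G y l) ρ A hρ hA fun y _ => hpow l hl y
    rwa [hn2] at this
  have htot : ∀ l, t < l → ∫⁻ y, ENNReal.ofReal |G y l|
      ≤ ENNReal.ofReal (C₀ * (A * R₂ ^ (2 * s))) := by
    intro l hl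
    rw [lintegral_eq_of_support n (hG₂ l hl)]
    exact hmass l hl R₂ hR₂
  refine ⟨?_, fun hx => ?_, fun hx => ?_⟩
  · have hR : 0 < R₁ / D := by positivity
    refine (h₁ G x t (R₁ / D) A (C₀ * (A * R₂ ^ (2 * s))) ht hR hA (by positivity) ?_
      (fun l hl => htot l (by linarith))).trans ?_
    · intro l hl hl2 y
      rcases lt_or_ge ‖y‖ (R₁ / D) with h | h
      · rw [hG₁ l hl hl2 y h, abs_zero]; positivity
      · rw [max_eq_right h]; exact hpow l hl y
    · refine ENNReal.ofReal_le_ofReal ?_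
      have e1 : 2 * s - (n - 2 * s) = 4 * s - n := by ring
      have e2 : (R₁ / D) ^ (4 * s - n) = D ^ (n - 4 * s) * R₁ ^ (4 * s - n) := by
        rw [Real.div_rpow hR₁.le hD.le, div_eq_mul_inv, ← Real.rpow_neg hD.le, neg_sub, mul_comm]
      -- Since `R₁ ≤ D` and `4s < n`, the late-time mass term is absorbed into the bound coming from
      -- `l ≤ 2t`.
      have e3 : 1 ≤ D ^ (n - 4 * s) * R₁ ^ (4 * s - n) := by
        rw [← e2]
        exact Real.one_le_rpow_of_pos_of_le_one_of_nonpos hR ((div_le_one hD).2 hR₁D)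
          (by linarith)
      rw [e1, e2]
      have e4 : R₂ ^ (2 * s) ≤ D ^ (2 * s) := Real.rpow_le_rpow hR₂.le hR₂D (by positivity)
      calc _ ≤ C₁ * (A * (D ^ (n - 4 * s) * R₁ ^ (4 * s - n))
              + C₀ * (A * D ^ (2 * s)) * (D ^ (n - 4 * s) * R₁ ^ (4 * s - n))) := by
            have e5 : C₀ * (A * R₂ ^ (2 * s))
                ≤ C₀ * (A * D ^ (2 * s)) * (D ^ (n - 4 * s) * R₁ ^ (4 * s - n)) := by
              refine le_trans ?_ (le_mul_of_one_le_right (by positivity) e3)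
              gcongr
            gcongr
        _ = k₁ * (A * R₁ ^ (4 * s - n)) := by rw [hk₁]; ring
        _ ≤ _ := by gcongr; linarith
  · have hx0 : 0 < ‖x‖ := norm_pos_iff.2 hx
    refine (h₂ G x t (C₀ * (A * (‖x‖ / 2) ^ (2 * s))) A hx (by positivity) hA
      (fun l hl y _ => hpow l hl y) fun l hl => hmass l hl _ (by positivity)).trans ?_
    refine ENNReal.ofReal_le_ofReal ?_
    calc _ = k₂ * (A * ‖x‖ ^ (4 * s - n)) := by
          have e1 : 2 * s - (n - 2 * s) = 4 * s - n := by ring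
          have e2 : ‖x‖ ^ (4 * s - n) = ‖x‖ ^ (2 * s) * ‖x‖ ^ (2 * s - n) := by
            rw [← Real.rpow_add hx0]; congr 1; ring
          have e3 : (‖x‖ / 2) ^ (2 * s) = (1 / 2) ^ (2 * s) * ‖x‖ ^ (2 * s) := by
            rw [← Real.mul_rpow (by positivity) (by positivity)]; congr 1; ring
          rw [e1, e2, e3, hk₂]; ring
      _ ≤ _ := by gcongr; linarith
  · have hx0 : 0 < ‖x‖ := norm_pos_iff.2 hx
    refine (h₃ G x t (C₀ * (A * R₂ ^ (2 * s))) (A * R₂ ^ (2 * s)) hx (by positivity)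
      (by positivity) (fun l hl y hy => ?_) fun l hl =>
        (setLIntegral_le_lintegral _ _).trans (htot l hl)).trans ?_
    · rcases lt_or_ge R₂ ‖y‖ with h | h
      · rw [hG₂ l hl y h, abs_zero]; positivity
      · have hy0 : 0 < ‖y‖ := by linarith
        refine (hG l hl y).trans ?_
        rw [mul_assoc]
        gcongr
        calc ‖y‖ ^ (2 * s - n) = ‖y‖ ^ (2 * s) * ‖y‖ ^ (-(n : ℝ)) := by
              rw [← Real.rpow_add hy0]; congr 1
          _ ≤ _ := by gcongr
    · refine ENNReal.ofReal_le_ofReal ?_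
      calc _ = k₃ * (A * R₂ ^ (2 * s) * ‖x‖ ^ (2 * s - n)) := by rw [hk₃]; ring
        _ ≤ _ := by gcongr; linarith

/-- Weights comparable to `A |y|^{-n-2s}` outside a ball. -/
lemma Tout_tail_le (n : ℕ) (hn1 : 1 ≤ n) {s D : ℝ} (hs : 0 < s) (hn : 2 * s < n)
    (hD : 0 < D) :
    ∃ C : ℝ, 0 < C ∧ ∀ (G : EuclideanSpace ℝ (Fin n) → ℝ → ℝ) (x : EuclideanSpace ℝ (Fin n))
      (t A R : ℝ), 1 ≤ t → 0 ≤ A → 0 < R → R ≤ D →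
      (∀ l, t < l → ∀ y, |G y l| ≤ A * ‖y‖ ^ (-(n : ℝ) - 2 * s)) →
      (∀ l, t < l → ∃ A' R' : ℝ, 0 ≤ A' ∧ 0 < R' ∧ A' * R' ^ (-(2 * s)) ≤ A * R ^ (-(2 * s)) ∧
        ∀ y, |G y l| ≤ A' * max R' ‖y‖ ^ (-(n : ℝ) - 2 * s)) →
      (∀ l, t < l → l ≤ 2 * t → ∀ y, ‖y‖ < R / D → G y l = 0) →
      Tout n s G x t ≤ ENNReal.ofReal (C * (A * R ^ (-(n : ℝ)))) ∧
      (R ≤ ‖x‖ → Tout n s G x t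
        ≤ ENNReal.ofReal (C * (A * R ^ (-(2 * s)) * ‖x‖ ^ (2 * s - n)))) := by
  obtain ⟨C₀, hC₀, h₀⟩ := lintegral_le_of_le_max n (b := 2 * s) (by positivity)
  obtain ⟨C₁, hC₁, h₁⟩ := Tout_le_of_doubling n hn1 hs hn
    (show 2 * s < n + 2 * s by linarith)
  obtain ⟨C₂, hC₂, h₂⟩ := Tout_le_of_mass n hn1 hs hn (show 2 * s < n + 2 * s by linarith)
  set k₁ := C₁ * (D ^ (n : ℝ) + C₀ * D ^ (n - 2 * s)) with hk₁
  set k₂ := C₂ * (C₀ + 1) with hk₂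
  have hk₁' : 0 < k₁ := by positivity
  have hk₂' : 0 < k₂ := by positivity
  refine ⟨k₁ + k₂, by positivity, fun G x t A R ht hA hR hRD hG hGm hG₁ => ?_⟩
  -- The bound by `A |y|^(-n-2s)` is not integrable at the origin, so the mass of each slice is
  -- computed with its own truncation radius `R'` and then compared with the value at time `t`.
  have htot : ∀ l, t < l → ∫⁻ y, ENNReal.ofReal |G y l|
      ≤ ENNReal.ofReal (C₀ * (A * R ^ (-(2 * s)))) := by
    intro l hl
    obtain ⟨A', R', hA', hR', hle, hb⟩ := hGm l hl
    refine (h₀ (fun y => G y l) R' A' hR' hA' hb).trans (ENNReal.ofReal_le_ofReal ?_)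
    gcongr
  have hpow : ∀ l, t < l → ∀ y, |G y l| ≤ A * ‖y‖ ^ (-(n + 2 * s)) := by
    intro l hl y
    rw [neg_add']; exact hG l hl y
  refine ⟨?_, fun hx => ?_⟩
  · have hR' : 0 < R / D := by positivity
    refine (h₁ G x t (R / D) A (C₀ * (A * R ^ (-(2 * s)))) ht hR' hA (by positivity) ?_
      (fun l hl => htot l (by linarith))).trans ?_
    · intro l hl hl2 y
      rcases lt_or_ge ‖y‖ (R / D) with h | h
      · rw [hG₁ l hl hl2 y h, abs_zero]; positivity
      · rw [max_eq_right h]; exact hpow l hl y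
    · refine ENNReal.ofReal_le_ofReal ?_
      have e1 : 2 * s - (n + 2 * s) = -n := by ring
      have e2 : (R / D) ^ (-(n : ℝ)) = D ^ (n : ℝ) * R ^ (-(n : ℝ)) := by
        rw [Real.div_rpow hR.le hD.le, div_eq_mul_inv, ← Real.rpow_neg hD.le, neg_neg, mul_comm]
      have e3 : R ^ (-(2 * s)) ≤ D ^ (n - 2 * s) * R ^ (-(n : ℝ)) := by
        calc R ^ (-(2 * s)) = R ^ (n - 2 * s) * R ^ (-(n : ℝ)) := by
              rw [← Real.rpow_add hR]; congr 1; ring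
          _ ≤ _ := by
              gcongr
      rw [e1, e2]
      calc _ ≤ C₁ * (A * (D ^ (n : ℝ) * R ^ (-(n : ℝ)))
              + C₀ * (A * (D ^ (n - 2 * s) * R ^ (-(n : ℝ))))) := by gcongr
        _ = k₁ * (A * R ^ (-(n : ℝ))) := by rw [hk₁]; ring
        _ ≤ _ := by gcongr; linarith
  · have hx0 : 0 < ‖x‖ := hR.trans_le hx
    refine (h₂ G x t (C₀ * (A * R ^ (-(2 * s)))) A (norm_pos_iff.1 hx0) (by positivity) hA
      (fun l hl y _ => hpow l hl y) fun l hl =>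
        (setLIntegral_le_lintegral _ _).trans (htot l hl)).trans ?_
    refine ENNReal.ofReal_le_ofReal ?_
    have e1 : ‖x‖ ^ (2 * s - (n + 2 * s)) ≤ R ^ (-(2 * s)) * ‖x‖ ^ (2 * s - n) := by
      calc _ = ‖x‖ ^ (-(2 * s)) * ‖x‖ ^ (2 * s - n) := by
            rw [← Real.rpow_add hx0]; congr 1; ring
        _ ≤ _ := by
            gcongr ?_ * _
            exact Real.rpow_le_rpow_of_nonpos hR hx (by linarith)
    calc _ ≤ C₂ * (C₀ * (A * R ^ (-(2 * s))) * ‖x‖ ^ (2 * s - n)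
            + A * (R ^ (-(2 * s)) * ‖x‖ ^ (2 * s - n))) := by gcongr
      _ = k₂ * (A * R ^ (-(2 * s)) * ‖x‖ ^ (2 * s - n)) := by rw [hk₂]; ring
      _ ≤ _ := by gcongr; linarith

end Profiles

/-! ### Arithmetic of multiples of powers of time. -/

section PowerFunctions

/-- `f` is a positive multiple of `t ↦ t^e` on `(0,∞)`. -/
def IsPow (f : ℝ → ℝ) (e : ℝ) : Prop := ∃ c : ℝ, 0 < c ∧ ∀ t : ℝ, 0 < t → f t = c * t ^ e

namespace IsPow

variable {f g : ℝ → ℝ} {a b : ℝ}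

lemma id_rpow (e : ℝ) : IsPow (fun t => t ^ e) e := ⟨1, one_pos, fun _ _ => (one_mul _).symm⟩

lemma mul (hf : IsPow f a) (hg : IsPow g b) : IsPow (fun t => f t * g t) (a + b) := by
  obtain ⟨c, hc, h⟩ := hf
  obtain ⟨d, hd, h'⟩ := hg
  refine ⟨c * d, by positivity, fun t ht => ?_⟩
  simp only [h t ht, h' t ht, Real.rpow_add ht]; ring

lemma rpow (hf : IsPow f a) (e : ℝ) : IsPow (fun t => f t ^ e) (a * e) := by
  obtain ⟨c, hc, h⟩ := hf
  refine ⟨c ^ e, by positivity, fun t ht => ?_⟩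
  change f t ^ e = _
  rw [h t ht, Real.mul_rpow hc.le (by positivity), ← Real.rpow_mul ht.le]

lemma div (hf : IsPow f a) (hg : IsPow g b) : IsPow (fun t => f t / g t) (a - b) := by
  obtain ⟨c, hc, h⟩ := hf
  obtain ⟨d, hd, h'⟩ := hg
  refine ⟨c / d, by positivity, fun t ht => ?_⟩
  simp only [h t ht, h' t ht, Real.rpow_sub ht]
  field_simp

lemma sqrt (hf : IsPow f a) : IsPow (fun t => √(f t)) (a / 2) := by
  simp_rw [Real.sqrt_eq_rpow]
  have := hf.rpow (1 / 2)
  rwa [mul_one_div] at this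

lemma pos (hf : IsPow f a) {t : ℝ} (ht : 0 < t) : 0 < f t := by
  obtain ⟨c, hc, h⟩ := hf
  rw [h t ht]; positivity

lemma antitone (hf : IsPow f a) (ha : a ≤ 0) {t l : ℝ} (ht : 0 < t) (hl : t ≤ l) :
    f l ≤ f t := by
  obtain ⟨c, hc, h⟩ := hf
  rw [h t ht, h l (ht.trans_le hl)]
  gcongr ?_ * ?_
  exact Real.rpow_le_rpow_of_nonpos ht hl ha

/-- The ratio `l/t` lies in `[1,2]`, so its powers `a` and `-a` are both at most `2^|a|`. -/
lemma doubling (hf : IsPow f a) :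
    ∃ D : ℝ, 0 < D ∧ ∀ t l : ℝ, 0 < t → t ≤ l → l ≤ 2 * t → f t / D ≤ f l ∧ f l ≤ D * f t := by
  obtain ⟨c, hc, h⟩ := hf
  have h1 : (1 : ℝ) ≤ 2 ^ |a| := Real.one_le_rpow (by norm_num) (abs_nonneg a)
  refine ⟨2 ^ |a|, by positivity, fun t l ht hl hl2 => ?_⟩
  have hl0 : 0 < l := ht.trans_le hl
  have key : ∀ e : ℝ, (l / t) ^ e ≤ 2 ^ |e| := by
    intro e
    have h2 : 1 ≤ l / t := (one_le_div ht).2 hl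
    calc (l / t) ^ e ≤ (l / t) ^ |e| := Real.rpow_le_rpow_of_exponent_le h2 (le_abs_self e)
      _ ≤ _ := Real.rpow_le_rpow (by positivity) ((div_le_iff₀ ht).2 hl2) (abs_nonneg e)
  rw [h t ht, h l hl0]
  constructor
  · have := key (-a)
    rw [abs_neg, Real.rpow_neg (by positivity), Real.div_rpow hl0.le ht.le, inv_div,
      div_le_iff₀ (by positivity)] at this
    rw [div_le_iff₀ (by positivity)]
    nlinarith
  · have := key a
    rw [Real.div_rpow hl0.le ht.le, div_le_iff₀ (by positivity)] at this
    nlinarith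

lemma bounded (hf : IsPow f a) (ha : a ≤ 0) :
    ∃ D : ℝ, 0 < D ∧ ∀ t : ℝ, 1 ≤ t → f t ≤ D :=
  ⟨f 1, hf.pos one_pos, fun _ ht => hf.antitone ha one_pos ht⟩

/-- Turns a cancellation of exponents into an identity of functions, without tracking the
coefficients `β_j`. -/
lemma eq_const (hf : IsPow f a) (ha : a = 0) :
    ∃ c : ℝ, 0 < c ∧ ∀ t : ℝ, 0 < t → f t = c := by
  obtain ⟨c, hc, h⟩ := hf
  refine ⟨c, hc, fun t ht => ?_⟩
  rw [h t ht, ha, Real.rpow_zero, mul_one]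

end IsPow

end PowerFunctions

/-! ### Positivity of the constants; the scales as power functions. -/

section Constants

/-- The normalizing constant of the bubble. -/
noncomputable def bubbleConst (n : ℕ) (s : ℝ) : ℝ :=
  ((2 : ℝ) ^ (2 * s) * Real.Gamma (((n : ℝ) + 2 * s) / 2) / Real.Gamma (((n : ℝ) - 2 * s) / 2))
      ^ (((n : ℝ) - 2 * s) / (4 * s))

lemma bubbleConst_pos (n : ℕ) {s : ℝ} (hs : 0 < s) (hn : 2 * s < n) : 0 < bubbleConst n s := by
  have h1 : 0 < Real.Gamma (((n : ℝ) + 2 * s) / 2) := Real.Gamma_pos_of_pos (by linarith)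
  have h2 : 0 < Real.Gamma (((n : ℝ) - 2 * s) / 2) := Real.Gamma_pos_of_pos (by linarith)
  unfold bubbleConst
  positivity

lemma bubble_eq (n : ℕ) (s : ℝ) (y : EuclideanSpace ℝ (Fin n)) :
    bubble n s y = bubbleConst n s * (1 + ‖y‖ ^ 2) ^ (-(((n : ℝ) - 2 * s) / 2)) := by
  unfold bubble bubbleConst
  rw [one_div, Real.inv_rpow (by positivity), Real.rpow_neg (by positivity)]

/-- The closed form shows at once the decay needed for square integrability and that the value at
the origin is not zero. -/
lemma dilationKernel_eq (n : ℕ) (s : ℝ) (y : EuclideanSpace ℝ (Fin n)) :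
    dilationKernel n s y = bubbleConst n s * (((n : ℝ) - 2 * s) / 2)
      * ((1 + ‖y‖ ^ 2) ^ (-(((n : ℝ) - 2 * s) / 2)) * ((1 - ‖y‖ ^ 2) / (1 + ‖y‖ ^ 2))) := by
  unfold dilationKernel
  have hpos : 0 < 1 + ‖y‖ ^ 2 := by positivity
  set m := ((n : ℝ) - 2 * s) / 2
  have hfun : bubble n s = fun y => bubbleConst n s * (1 + ‖y‖ ^ 2) ^ (-m) :=
    funext fun y => bubble_eq n s y
  have h1 : HasFDerivAt (fun y : EuclideanSpace ℝ (Fin n) => 1 + ‖y‖ ^ 2) _ y :=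
    (hasStrictFDerivAt_norm_sq y).hasFDerivAt.const_add 1
  have h2 := (h1.rpow_const (p := -m) (Or.inl hpos.ne')).const_mul (bubbleConst n s)
  rw [hfun, h2.fderiv]
  have h3 : (1 + ‖y‖ ^ 2) ^ (-m - 1) = (1 + ‖y‖ ^ 2) ^ (-m) / (1 + ‖y‖ ^ 2) := by
    rw [Real.rpow_sub hpos, Real.rpow_one]
  simp [h3]
  field_simp
  ring

lemma integral_bubble_rpow_pos (n : ℕ) {s : ℝ} (hs : 0 < s) (hn : 2 * s < n) :
    0 < ∫ y, bubble n s y ^ (((n : ℝ) + 2 * s) / ((n : ℝ) - 2 * s)) := by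
  have hb := bubbleConst_pos n hs hn
  have heq : ∀ y, bubble n s y ^ (((n : ℝ) + 2 * s) / ((n : ℝ) - 2 * s))
      = bubbleConst n s ^ (((n : ℝ) + 2 * s) / ((n : ℝ) - 2 * s))
        * (1 + ‖y‖ ^ 2) ^ (-((n : ℝ) + 2 * s) / 2) := by
    intro y
    have : (n : ℝ) - 2 * s ≠ 0 := by linarith
    rw [bubble_eq, Real.mul_rpow hb.le (by positivity), ← Real.rpow_mul (by positivity)]
    congr 2
    field_simp
  simp_rw [heq]
  rw [integral_const_mul]
  refine mul_pos (by positivity) ?_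
  have hint := integrable_rpow_neg_one_add_norm_sq
    (μ := (volume : Measure (EuclideanSpace ℝ (Fin n)))) (r := n + 2 * s) (by simpa using hs)
  rw [integral_pos_iff_support_of_nonneg (fun y => by positivity) hint]
  have : Function.support (fun y : EuclideanSpace ℝ (Fin n) =>
      (1 + ‖y‖ ^ 2) ^ (-((n : ℝ) + 2 * s) / 2)) = univ := by
    refine eq_univ_of_forall fun y => ?_
    rw [Function.mem_support]
    positivity
  rw [this]
  exact isOpen_univ.measure_pos _ univ_nonempty

/-- Square integrability needs `n > 4s`; without it the Bochner integral would be `0` by convention.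
Positivity then follows from continuity and `Z_{n+1}(0) ≠ 0`. -/
lemma integral_dilationKernel_sq_pos (n : ℕ) {s : ℝ} (hs : 0 < s) (hn : 4 * s < n) :
    0 < ∫ y, dilationKernel n s y ^ 2 := by
  have hb := bubbleConst_pos n hs (show 2 * s < n by linarith)
  set k := bubbleConst n s * (((n : ℝ) - 2 * s) / 2) with hk
  have hk0 : 0 < k := mul_pos hb (by linarith)
  have hcont : Continuous fun y => dilationKernel n s y ^ 2 := by
    simp_rw [dilationKernel_eq]
    have hp : ∀ y : EuclideanSpace ℝ (Fin n), 1 + ‖y‖ ^ 2 ≠ 0 := fun y => by positivity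
    refine (continuous_const.mul (Continuous.mul ?_ ?_)).pow 2
    · exact Continuous.rpow_const (by fun_prop) fun y => Or.inl (hp y)
    · exact Continuous.div (by fun_prop) (by fun_prop) hp
  have hint : Integrable fun y : EuclideanSpace ℝ (Fin n) => dilationKernel n s y ^ 2 := by
    have h := (integrable_rpow_neg_one_add_norm_sq
      (μ := (volume : Measure (EuclideanSpace ℝ (Fin n)))) (r := 2 * (n - 2 * s))
      (by rw [finrank_euclideanSpace_fin]; linarith)).const_mul (k ^ 2)
    refine h.mono' hcont.aestronglyMeasurable (ae_of_all _ fun y => ?_)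
    have hp : 0 < 1 + ‖y‖ ^ 2 := by positivity
    have h1 : ((1 - ‖y‖ ^ 2) / (1 + ‖y‖ ^ 2)) ^ 2 ≤ 1 := by
      rw [div_pow, div_le_one (by positivity)]
      nlinarith [sq_nonneg ‖y‖]
    have h2 : ((1 + ‖y‖ ^ 2) ^ (-(((n : ℝ) - 2 * s) / 2))) ^ 2
        = (1 + ‖y‖ ^ 2) ^ (-(2 * (n - 2 * s)) / 2) := by
      rw [← Real.rpow_natCast, ← Real.rpow_mul hp.le]
      congr 1; push_cast; ring
    rw [Real.norm_of_nonneg (by positivity), dilationKernel_eq, ← hk, mul_pow k, mul_pow (_ ^ _), h2]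
    exact mul_le_mul_of_nonneg_left (mul_le_of_le_one_right (by positivity) h1) (by positivity)
  rw [integral_pos_iff_support_of_nonneg (fun y => by positivity) hint]
  refine hcont.isOpen_support.measure_pos _ ⟨0, ?_⟩
  rw [Function.mem_support, dilationKernel_eq, ← hk]
  simp [hk0.ne']

/-- Only the sign of `c` matters: it makes every `β_j` positive, so that each `μ_{0,j}` is a
positive power function. -/
lemma cConst_pos (n : ℕ) {s : ℝ} (hs : 0 < s) (hn : 4 * s < n) : 0 < cConst n s := by
  unfold cConst
  have h0 : 0 < bubble n s 0 := by
    rw [bubble_eq]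
    have := bubbleConst_pos n hs (show 2 * s < n by linarith)
    positivity
  exact div_pos (mul_pos (mul_pos h0 (by linarith)) (integral_bubble_rpow_pos n hs (by linarith)))
    (integral_dilationKernel_sq_pos n hs hn)

lemma one_lt_ratio (n : ℕ) {s : ℝ} (hs : 0 < s) (hn : 6 * s < n) :
    1 < ((n : ℝ) - 2 * s) / ((n : ℝ) - 6 * s) := by
  rw [one_lt_div (by linarith)]; linarith

lemma aExp_one (n : ℕ) (s : ℝ) : aExp n s 1 = 0 := by simp [aExp]

lemma aExp_pos (n : ℕ) {s : ℝ} (hs : 0 < s) (hn : 6 * s < n) {j : ℕ} (hj : 2 ≤ j) :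
    0 < aExp n s j := by
  unfold aExp
  have h := one_lt_pow₀ (one_lt_ratio n hs hn) (show j - 1 ≠ 0 by omega)
  have : 0 < 1 / (2 * s) := by positivity
  nlinarith

lemma aExp_mono (n : ℕ) {s : ℝ} (hs : 0 < s) (hn : 6 * s < n) {i j : ℕ} (hij : i ≤ j) :
    aExp n s i ≤ aExp n s j := by
  unfold aExp
  have h := pow_le_pow_right₀ (one_lt_ratio n hs hn).le (show i - 1 ≤ j - 1 by omega)
  have : 0 < 1 / (2 * s) := by positivity
  nlinarith

lemma aExp_nonneg (n : ℕ) {s : ℝ} (hs : 0 < s) (hn : 6 * s < n) {j : ℕ} (hj : 1 ≤ j) :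
    0 ≤ aExp n s j := by
  rw [← aExp_one n s]; exact aExp_mono n hs hn hj

lemma bCoef_pos (n : ℕ) {s : ℝ} (hs : 0 < s) (hn : 6 * s < n) : ∀ j, 0 < bCoef n s j
  | 0 => one_pos
  | 1 => one_pos
  | j + 2 => by
      have h1 := aExp_pos n hs hn (show 2 ≤ j + 2 by omega)
      have h2 := cConst_pos n hs (show 4 * s < n by linarith)
      have h3 := bCoef_pos n hs hn (j + 1)
      unfold bCoef
      positivity

lemma isPow_mu (n : ℕ) {s : ℝ} (hs : 0 < s) (hn : 6 * s < n) (j : ℕ) :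
    IsPow (mu n s j) (-aExp n s j) :=
  ⟨bCoef n s j, bCoef_pos n hs hn j, fun _ _ => rfl⟩

lemma muBar_eq_sqrt (n : ℕ) (s δ : ℝ) {j : ℕ} (hj : 2 ≤ j) :
    muBar n s δ j = fun t => √(mu n s j t * mu n s (j - 1) t) := by
  funext t
  rw [muBar, if_neg (by omega)]

lemma isPow_muBar (n : ℕ) {s : ℝ} (hs : 0 < s) (hn : 6 * s < n) (δ : ℝ) {j : ℕ} (hj : 2 ≤ j) :
    IsPow (muBar n s δ j) ((-aExp n s j + -aExp n s (j - 1)) / 2) := by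
  rw [muBar_eq_sqrt n s δ hj]
  exact ((isPow_mu n hs hn j).mul (isPow_mu n hs hn (j - 1))).sqrt

/-- With the exponent written as `2e` the square root disappears, and powers of `μ̄_{0,j}` can
cancel against those of `μ_{0,j}` and `μ_{0,j-1}`. -/
lemma muBar_rpow (n : ℕ) {s : ℝ} (hs : 0 < s) (hn : 6 * s < n) (δ e : ℝ) {j : ℕ} (hj : 2 ≤ j)
    {t : ℝ} (ht : 0 < t) :
    muBar n s δ j t ^ (2 * e) = mu n s j t ^ e * mu n s (j - 1) t ^ e := by
  have h1 := (isPow_mu n hs hn j).pos ht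
  have h2 := (isPow_mu n hs hn (j - 1)).pos ht
  rw [muBar, if_neg (by omega), Real.sqrt_eq_rpow, ← Real.rpow_mul (by positivity),
    Real.mul_rpow h1.le h2.le]
  congr 2 <;> ring

lemma mu_one (n : ℕ) (s : ℝ) (t : ℝ) : mu n s 1 t = 1 := by
  simp [mu, aExp_one, bCoef]

lemma gam_of_two_le (n : ℕ) (s σ : ℝ) {j : ℕ} (hj : 2 ≤ j) :
    gam n s σ j = ((n : ℝ) - 2 * s) / 2 * aExp n s (j - 1) - σ := by
  rw [gam, if_neg (by omega)]

lemma muBar_one (n : ℕ) (s δ t : ℝ) : muBar n s δ 1 t = t ^ δ := by simp [muBar]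

lemma gam_one (n : ℕ) (s σ : ℝ) : gam n s σ 1 = -1 - σ := by simp [gam]

lemma ind_of {P : Prop} (h : P) : ind P = 1 := by simp [ind, h]

lemma ind_of_not {P : Prop} (h : ¬P) : ind P = 0 := by simp [ind, h]

end Constants

/-! ### Profiles with time-dependent coefficients and radii. -/

section WeightProfiles

/-- Nonpositive exponents make `A` and `R₂` nonincreasing, so their values at `t` control all later
times. The inner radius decreases too, which is the unfavourable direction; it is only used for `l ≤
2t`, where it stays comparable to `R₁ t`. -/
lemma annulus_weight_bound (n : ℕ) (hn1 : 1 ≤ n) {s : ℝ} (hs : 0 < s) (hn : 4 * s < n)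
    {A R₁ R₂ : ℝ → ℝ} {a r₁ r₂ : ℝ} (hA : IsPow A a) (ha : a ≤ 0) (hR₁ : IsPow R₁ r₁)
    (hr₁ : r₁ ≤ 0) (hR₂ : IsPow R₂ r₂) (hr₂ : r₂ ≤ 0)
    {G : EuclideanSpace ℝ (Fin n) → ℝ → ℝ}
    (hG : ∀ y l, G y l = A l * ‖y‖ ^ (2 * s - n) * ind (R₁ l ≤ ‖y‖ ∧ ‖y‖ ≤ R₂ l)) :
    ∃ C : ℝ, 0 < C ∧ ∀ (x : EuclideanSpace ℝ (Fin n)) (t : ℝ), 1 < t →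
      Tout n s G x t ≤ ENNReal.ofReal (C * (A t * R₁ t ^ (4 * s - n))) ∧
      (x ≠ 0 → Tout n s G x t ≤ ENNReal.ofReal (C * (A t * ‖x‖ ^ (4 * s - n)))) ∧
      (x ≠ 0 → Tout n s G x t
        ≤ ENNReal.ofReal (C * (A t * R₂ t ^ (2 * s) * ‖x‖ ^ (2 * s - n)))) := by
  obtain ⟨D₁, hD₁, h₁⟩ := hR₁.bounded hr₁
  obtain ⟨D₂, hD₂, h₂⟩ := hR₂.bounded hr₂
  obtain ⟨D₃, hD₃, h₃⟩ := hR₁.doubling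
  obtain ⟨C, hC, h⟩ := Tout_annulus_le n hn1 hs hn (D := D₁ + D₂ + D₃) (by positivity)
  refine ⟨C, hC, fun x t ht => ?_⟩
  have ht0 : 0 < t := by linarith
  have hAt := hA.pos ht0
  have hR₁t := hR₁.pos ht0
  refine h G x t (A t) (R₁ t) (R₂ t) ht.le hAt.le hR₁t (by linarith [h₁ t ht.le])
    (hR₂.pos ht0) (by linarith [h₂ t ht.le]) ?_ ?_ ?_
  · intro l hl y
    have hAl := hA.pos (ht0.trans hl)
    rw [hG]
    by_cases hy : R₁ l ≤ ‖y‖ ∧ ‖y‖ ≤ R₂ l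
    · rw [ind_of hy, mul_one, abs_of_nonneg (by positivity)]
      gcongr
      exact hA.antitone ha ht0 hl.le
    · rw [ind_of_not hy, mul_zero, abs_zero]; positivity
  · intro l hl y hy
    rw [hG, ind_of_not, mul_zero]
    rintro ⟨-, h'⟩
    linarith [hR₂.antitone hr₂ ht0 hl.le]
  · intro l hl hl2 y hy
    rw [hG, ind_of_not, mul_zero]
    rintro ⟨h', -⟩
    have h4 := (h₃ t l ht0 hl.le hl2).1
    have h5 : R₁ t / (D₁ + D₂ + D₃) ≤ R₁ t / D₃ := by gcongr; linarith
    linarith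

/-- A slice has mass of order `A R^(-2s)`. Shrinking `R` increases this, and `har` says that the
decay of `A` compensates. -/
lemma tail_weight_bound (n : ℕ) (hn1 : 1 ≤ n) {s : ℝ} (hs : 0 < s) (hn : 2 * s < n)
    {A R : ℝ → ℝ} {a r : ℝ} (hA : IsPow A a) (ha : a ≤ 0) (hR : IsPow R r) (hr : r ≤ 0)
    (har : a + r * (-(2 * s)) ≤ 0) {G : EuclideanSpace ℝ (Fin n) → ℝ → ℝ}
    (hG : ∀ y l, G y l = A l * ‖y‖ ^ (-(n : ℝ) - 2 * s) * ind (R l ≤ ‖y‖)) :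
    ∃ C : ℝ, 0 < C ∧ ∀ (x : EuclideanSpace ℝ (Fin n)) (t : ℝ), 1 < t →
      Tout n s G x t ≤ ENNReal.ofReal (C * (A t * R t ^ (-(n : ℝ)))) ∧
      (R t ≤ ‖x‖ → Tout n s G x t
        ≤ ENNReal.ofReal (C * (A t * R t ^ (-(2 * s)) * ‖x‖ ^ (2 * s - n)))) := by
  obtain ⟨D₁, hD₁, h₁⟩ := hR.bounded hr
  obtain ⟨D₃, hD₃, h₃⟩ := hR.doubling
  obtain ⟨C, hC, h⟩ := Tout_tail_le n hn1 hs hn (D := D₁ + D₃) (by positivity)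
  refine ⟨C, hC, fun x t ht => ?_⟩
  have ht0 : 0 < t := by linarith
  have hAt := hA.pos ht0
  have hRt := hR.pos ht0
  refine h G x t (A t) (R t) ht.le hAt.le hRt (by linarith [h₁ t ht.le]) ?_ ?_ ?_
  · intro l hl y
    have hAl := hA.pos (ht0.trans hl)
    rw [hG]
    by_cases hy : R l ≤ ‖y‖
    · rw [ind_of hy, mul_one, abs_of_nonneg (by positivity)]
      gcongr
      exact hA.antitone ha ht0 hl.le
    · rw [ind_of_not hy, mul_zero, abs_zero]; positivity
  · intro l hl
    have hAl := hA.pos (ht0.trans hl)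
    have hRl := hR.pos (ht0.trans hl)
    refine ⟨A l, R l, hAl.le, hRl, (hA.mul (hR.rpow (-(2 * s)))).antitone har ht0 hl.le,
      fun y => ?_⟩
    rw [hG]
    by_cases hy : R l ≤ ‖y‖
    · rw [ind_of hy, mul_one, abs_of_nonneg (by positivity), max_eq_right hy]
    · rw [ind_of_not hy, mul_zero, abs_zero]; positivity
  · intro l hl hl2 y hy
    rw [hG, ind_of_not, mul_zero]
    intro h'
    have h4 := (h₃ t l ht0 hl.le hl2).1
    have h5 : R t / (D₁ + D₃) ≤ R t / D₃ := by gcongr; linarith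
    linarith

/-- After multiplication by `μ^a` the denominator is `μ^a + r^a`, and `max(μ,r)^a` is one of its two
terms. -/
lemma inv_one_add_div_rpow_le {μ r a : ℝ} (hμ : 0 < μ) (hr : 0 ≤ r) :
    1 / (1 + (r / μ) ^ a) ≤ μ ^ a * max μ r ^ (-a) := by
  have hm : 0 < max μ r := lt_max_of_lt_left hμ
  rw [Real.rpow_neg hm.le, ← div_eq_mul_inv, div_le_div_iff₀ (by positivity) (by positivity),
    Real.div_rpow hr hμ.le, one_mul]
  have h1 : μ ^ a * (1 + r ^ a / μ ^ a) = μ ^ a + r ^ a := by field_simp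
  rw [h1]
  have h2 : 0 < μ ^ a := by positivity
  have h3 : 0 ≤ r ^ a := by positivity
  rcases le_total μ r with h | h
  · rw [max_eq_right h]; linarith
  · rw [max_eq_left h]; linarith

lemma core_weight_le {n : ℕ} {a : ℝ} {k μ ρ : ℝ} (hk : 0 < k) (hμ : 0 < μ)
    (y : EuclideanSpace ℝ (Fin n)) :
    |k / (1 + (‖y‖ / μ) ^ a) * ind (‖y‖ ≤ 2 * ρ)| ≤ k * μ ^ a * max μ ‖y‖ ^ (-a) := by
  have h := inv_one_add_div_rpow_le (a := a) hμ (norm_nonneg y)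
  by_cases hy : ‖y‖ ≤ 2 * ρ
  · rw [ind_of hy, mul_one, abs_of_nonneg (by positivity), div_eq_mul_one_div, mul_assoc]
    gcongr
  · rw [ind_of_not hy, mul_zero, abs_zero]; positivity

/-- Decay of the potential of a concentrated weight away from the origin. -/
lemma core_weight_decay (n : ℕ) (hn1 : 1 ≤ n) {s a : ℝ} (hs : 0 < s) (hn : 2 * s < n)
    (ha : 0 < a) (han : a < n) {K μ ρ : ℝ → ℝ} {κ m r : ℝ} (hK : IsPow K κ) (hμ : IsPow μ m)
    (hρ : IsPow ρ r) (he : κ + m * a + r * (n - a) ≤ 0)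
    {G : EuclideanSpace ℝ (Fin n) → ℝ → ℝ}
    (hG : ∀ y l, G y l = K l / (1 + (‖y‖ / μ l) ^ a) * ind (‖y‖ ≤ 2 * ρ l)) :
    ∃ C : ℝ, 0 < C ∧ ∀ t : ℝ, 1 < t →
      (∀ l, t < l → ∫⁻ y, ENNReal.ofReal |G y l|
        ≤ ENNReal.ofReal (C * (K t * μ t ^ a * ρ t ^ (n - a)))) ∧
      ∀ x : EuclideanSpace ℝ (Fin n), x ≠ 0 →
      Tout n s G x t
        ≤ ENNReal.ofReal (C * (K t * μ t ^ a * ρ t ^ (n - a) * ‖x‖ ^ (2 * s - n))) := by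
  obtain ⟨C₀, hC₀, h₀⟩ := setLIntegral_le_of_le_rpow n hn1 han
  obtain ⟨C₁, hC₁, h₁⟩ := Tout_le_of_mass n hn1 hs hn hn
  set d : ℝ := 2 ^ (n - a) with hd
  have hd0 : 0 < d := by positivity
  have hM : IsPow (fun t => K t * μ t ^ a * ρ t ^ (n - a)) (κ + m * a + r * (n - a)) :=
    (hK.mul (hμ.rpow a)).mul (hρ.rpow _)
  refine ⟨C₀ * d + C₁ * (C₀ * d + d), by positivity, fun t ht => ?_⟩
  have ht0 : 0 < t := by linarith
  have hMt := hM.pos ht0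
  -- The hypothesis `he` says exactly that `K μ^a ρ^(n-a)`, the order of the mass of a slice, is
  -- nonincreasing in time.
  have hMl : ∀ l, t < l → K l * μ l ^ a * (2 * ρ l) ^ (n - a)
      ≤ d * (K t * μ t ^ a * ρ t ^ (n - a)) := by
    intro l hl
    rw [Real.mul_rpow (by norm_num) (hρ.pos (ht0.trans hl)).le]
    calc _ = d * (K l * μ l ^ a * ρ l ^ (n - a)) := by rw [hd]; ring
      _ ≤ _ := by
        exact mul_le_mul_of_nonneg_left (hM.antitone he ht0 hl.le) hd0.le
  have hGle : ∀ l, t < l → ∀ y, y ≠ 0 → |G y l| ≤ K l * μ l ^ a * ‖y‖ ^ (-a) := by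
    intro l hl y hy
    have hKl := hK.pos (ht0.trans hl)
    have hμl := hμ.pos (ht0.trans hl)
    rw [hG]
    refine (core_weight_le hKl hμl y).trans ?_
    gcongr ?_ * ?_
    exact Real.rpow_le_rpow_of_nonpos (norm_pos_iff.2 hy) (le_max_right _ _) (by linarith)
  have hsupp : ∀ l, ∀ y, 2 * ρ l < ‖y‖ → G y l = 0 := by
    intro l y hy
    rw [hG, ind_of_not (not_le.2 hy), mul_zero]
  have hmass : ∀ l, t < l → ∫⁻ y, ENNReal.ofReal |G y l|
      ≤ ENNReal.ofReal (C₀ * d * (K t * μ t ^ a * ρ t ^ (n - a))) := by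
    intro l hl
    have hKl := hK.pos (ht0.trans hl)
    have hμl := hμ.pos (ht0.trans hl)
    have hρl := hρ.pos (ht0.trans hl)
    rw [lintegral_eq_of_support n (hsupp l)]
    refine (h₀ (fun y => G y l) (2 * ρ l) (K l * μ l ^ a) (by positivity) (by positivity)
      (hGle l hl)).trans (ENNReal.ofReal_le_ofReal ?_)
    rw [mul_assoc C₀]
    exact mul_le_mul_of_nonneg_left (hMl l hl) hC₀.le
  refine ⟨fun l hl => (hmass l hl).trans (ENNReal.ofReal_le_ofReal ?_), fun x hx => ?_⟩
  · gcongr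
    have : 0 < C₁ * (C₀ * d + d) := by positivity
    linarith
  · have hx0 : 0 < ‖x‖ := norm_pos_iff.2 hx
    refine (h₁ G x t (C₀ * d * (K t * μ t ^ a * ρ t ^ (n - a)))
      (d * (K t * μ t ^ a * ρ t ^ (n - a))) hx (by positivity) (by positivity)
      (fun l hl y hy => ?_) fun l hl => (setLIntegral_le_lintegral _ _).trans (hmass l hl)).trans
      (ENNReal.ofReal_le_ofReal ?_)
    · rcases lt_or_ge (2 * ρ l) ‖y‖ with h | h
      · rw [hsupp l y h, abs_zero]; positivity
      · have hy0 : 0 < ‖y‖ := by linarith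
        have hKl := hK.pos (ht0.trans hl)
        have hμl := hμ.pos (ht0.trans hl)
        refine (hGle l hl y (norm_pos_iff.1 hy0)).trans ?_
        calc _ = K l * μ l ^ a * ‖y‖ ^ (n - a) * ‖y‖ ^ (-(n : ℝ)) := by
              rw [mul_assoc, mul_assoc, mul_assoc, ← Real.rpow_add hy0]
              congr 3; ring
          _ ≤ K l * μ l ^ a * (2 * ρ l) ^ (n - a) * ‖y‖ ^ (-(n : ℝ)) := by
              gcongr
          _ ≤ _ := mul_le_mul_of_nonneg_right (hMl l hl) (by positivity)
    · have p : 0 ≤ C₀ * d * (K t * μ t ^ a * ρ t ^ (n - a) * ‖x‖ ^ (2 * s - n)) := by positivity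
      nlinarith

/-- Bound of the potential of a concentrated weight near the origin. -/
lemma core_weight_bound (n : ℕ) (hn1 : 1 ≤ n) {s a : ℝ} (hs : 0 < s) (hn : 2 * s < n)
    (ha : 2 * s < a) (han : a < n) {K μ ρ : ℝ → ℝ} {κ m r : ℝ} (hK : IsPow K κ)
    (hμ : IsPow μ m) (hρ : IsPow ρ r) (he : κ + m * a + r * (n - a) ≤ 0)
    {G : EuclideanSpace ℝ (Fin n) → ℝ → ℝ}
    (hG : ∀ y l, G y l = K l / (1 + (‖y‖ / μ l) ^ a) * ind (‖y‖ ≤ 2 * ρ l)) :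
    ∃ C : ℝ, 0 < C ∧ ∀ (x : EuclideanSpace ℝ (Fin n)) (t : ℝ), 1 < t →
      Tout n s G x t ≤ ENNReal.ofReal
        (C * (K t * μ t ^ (2 * s) + K t * μ t ^ a * ρ t ^ (n - a))) := by
  obtain ⟨C₀, hC₀, h₀⟩ := core_weight_decay n hn1 hs hn (by linarith) han hK hμ hρ he hG
  obtain ⟨C₁, hC₁, h₁⟩ := Tout_le_of_doubling n hn1 hs hn ha
  obtain ⟨D₁, hD₁, hd₁⟩ := (hK.mul (hμ.rpow a)).doubling
  obtain ⟨D₂, hD₂, hd₂⟩ := hμ.doubling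
  set d : ℝ := D₁ * D₂ ^ (a - 2 * s) with hd
  have hd0 : 0 < d := by positivity
  refine ⟨C₁ * (d + C₀), by positivity, fun x t ht => ?_⟩
  have ht0 : 0 < t := by linarith
  have hKt := hK.pos ht0
  have hμt := hμ.pos ht0
  have hρt := hρ.pos ht0
  refine (h₁ G x t (μ t / D₂) (D₁ * (K t * μ t ^ a)) (C₀ * (K t * μ t ^ a * ρ t ^ (n - a)))
    ht.le (by positivity) (by positivity) (by positivity) (fun l hl hl2 y => ?_)
    (fun l hl => (h₀ t ht).1 l (by linarith))).trans (ENNReal.ofReal_le_ofReal ?_)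
  · have hKl := hK.pos (ht0.trans hl)
    have hμl := hμ.pos (ht0.trans hl)
    rw [hG]
    refine (core_weight_le hKl hμl y).trans ?_
    have hm : 0 < max (μ t / D₂) ‖y‖ := lt_max_of_lt_left (by positivity)
    gcongr ?_ * ?_
    · exact (hd₁ t l ht0 hl.le hl2).2
    · exact Real.rpow_le_rpow_of_nonpos hm (max_le_max_right _ (hd₂ t l ht0 hl.le hl2).1)
        (by linarith)
  · have e1 : D₁ * (K t * μ t ^ a) * (μ t / D₂) ^ (2 * s - a) = d * (K t * μ t ^ (2 * s)) := by
      rw [Real.div_rpow hμt.le hD₂.le, div_eq_mul_inv, ← Real.rpow_neg hD₂.le, neg_sub, hd]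
      have : μ t ^ (2 * s) = μ t ^ a * μ t ^ (2 * s - a) := by
        rw [← Real.rpow_add hμt]; congr 1; ring
      rw [this]; ring
    rw [e1]
    have p1 : 0 ≤ C₀ * (K t * μ t ^ (2 * s)) := by positivity
    have p2 : 0 ≤ d * (K t * μ t ^ a * ρ t ^ (n - a)) := by positivity
    rw [mul_assoc C₁]
    refine mul_le_mul_of_nonneg_left ?_ hC₁.le
    nlinarith

/-- Weights decaying in time like `l^{-1-τ}`, uniformly bounded by the Riesz kernel in space. -/
lemma Tout_le_of_time_decay (n : ℕ) (hn1 : 1 ≤ n) {s τ : ℝ} (hs : 0 < s) (hn : 2 * s < n)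
    (hτ : 0 < τ) :
    ∃ C : ℝ, 0 < C ∧ ∀ (G : EuclideanSpace ℝ (Fin n) → ℝ → ℝ) (x : EuclideanSpace ℝ (Fin n))
      (t : ℝ), 0 < t → x ≠ 0 →
      (∀ l, t < l → ∀ y, |G y l| ≤ l ^ (-1 - τ) * ‖y‖ ^ (2 * s - n)) →
      Tout n s G x t ≤ ENNReal.ofReal (C * (t ^ (-τ) * ‖x‖ ^ (2 * s - n))) := by
  obtain ⟨C₀, hC₀, h₀⟩ := setLIntegral_le_of_le_rpow n hn1 (c := n - 2 * s) (by linarith)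
  obtain ⟨C₁, hC₁, h₁⟩ := lintegral_heatKernel_space_le n hs
  set c : ℝ := 4 ^ (((n : ℝ) + 2 * s) / 2) with hc
  have hc0 : 0 < c := by positivity
  set d : ℝ := c * C₀ * (1 / 2) ^ (2 * s) + C₁ * (1 / 2) ^ (2 * s - n) with hd
  have hd0 : 0 < d := by positivity
  refine ⟨d / τ, by positivity, fun G x t ht hx hG => ?_⟩
  have hx0 : 0 < ‖x‖ := norm_pos_iff.2 hx
  have hhalf : ∀ e : ℝ, (‖x‖ / 2) ^ e = (1 / 2) ^ e * ‖x‖ ^ e := by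
    intro e
    rw [← Real.mul_rpow (by positivity) (by positivity)]; congr 1; ring
  -- Inside `|y| ≤ |x|/2` the kernel is `O(|x|^(-n))` and `|y|^(2s-n)` has mass `O(|x|^(2s))`;
  -- outside, the weight is `O(|x|^(2s-n))` and the kernel has bounded mass. Only `l^(-1-τ)` is left
  -- to integrate in time.
  have hslice : ∀ l, t < l → ∫⁻ y, ENNReal.ofReal (heatKernel n s (x - y) (l - t) * |G y l|)
      ≤ ENNReal.ofReal (d * ‖x‖ ^ (2 * s - n)) * ENNReal.ofReal (l ^ (-1 - τ)) := by
    intro l hl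
    have hl0 : 0 < l := ht.trans hl
    have hlt : 0 < l - t := sub_pos.2 hl
    rw [← lintegral_add_compl _ (measurableSet_norm_le n (‖x‖ / 2))]
    have hin : ∫⁻ y in {y | ‖y‖ ≤ ‖x‖ / 2},
        ENNReal.ofReal (heatKernel n s (x - y) (l - t) * |G y l|)
        ≤ ENNReal.ofReal (c * C₀ * (1 / 2) ^ (2 * s) * ‖x‖ ^ (2 * s - n) * l ^ (-1 - τ)) := by
      calc _ ≤ ∫⁻ y in {y | ‖y‖ ≤ ‖x‖ / 2},
            ENNReal.ofReal (c * ‖x‖ ^ (-(n : ℝ))) * ENNReal.ofReal |G y l| := by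
            refine setLIntegral_mono' (measurableSet_norm_le n _) fun y hy => ?_
            rw [← ENNReal.ofReal_mul (by positivity)]
            refine ENNReal.ofReal_le_ofReal ?_
            gcongr
            refine (heatKernel_sub_le n hs hy hlt).trans ?_
            gcongr
            exact heatKernel_le_norm n hs hx hlt
        _ ≤ ENNReal.ofReal (c * ‖x‖ ^ (-(n : ℝ))) *
              ENNReal.ofReal (C₀ * (l ^ (-1 - τ) * (‖x‖ / 2) ^ ((n : ℝ) - (n - 2 * s)))) := by
            rw [lintegral_const_mul' _ _ ENNReal.ofReal_ne_top]
            gcongr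
            refine h₀ (fun y => G y l) _ _ (by positivity) (by positivity) fun y _ => ?_
            rw [neg_sub]
            exact hG l hl y
        _ = _ := by
            rw [← ENNReal.ofReal_mul (by positivity)]
            congr 1
            have : ‖x‖ ^ (2 * s - n) = ‖x‖ ^ (2 * s) * ‖x‖ ^ (-(n : ℝ)) := by
              rw [← Real.rpow_add hx0]; congr 1
            rw [sub_sub_cancel, hhalf, this]
            ring
    have hout : ∫⁻ y in {y | ‖y‖ ≤ ‖x‖ / 2}ᶜ,
        ENNReal.ofReal (heatKernel n s (x - y) (l - t) * |G y l|)
        ≤ ENNReal.ofReal (C₁ * (1 / 2) ^ (2 * s - n) * ‖x‖ ^ (2 * s - n) * l ^ (-1 - τ)) := by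
      calc _ ≤ ∫⁻ y in {y | ‖y‖ ≤ ‖x‖ / 2}ᶜ, ENNReal.ofReal (heatKernel n s (x - y) (l - t)) *
            ENNReal.ofReal (l ^ (-1 - τ) * (‖x‖ / 2) ^ (2 * s - n)) := by
            refine setLIntegral_mono' (measurableSet_norm_le n _).compl fun y hy => ?_
            have hk := heatKernel_nonneg n s (x - y) hlt.le
            have hy' : ‖x‖ / 2 ≤ ‖y‖ := by
              simp only [mem_compl_iff, mem_ofPred_eq, not_le] at hy
              exact hy.le
            rw [← ENNReal.ofReal_mul hk]
            refine ENNReal.ofReal_le_ofReal ?_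
            gcongr
            refine (hG l hl y).trans ?_
            gcongr ?_ * ?_
            exact Real.rpow_le_rpow_of_nonpos (by positivity) hy' (by linarith)
        _ ≤ ∫⁻ y, ENNReal.ofReal (heatKernel n s (x - y) (l - t)) *
            ENNReal.ofReal (l ^ (-1 - τ) * (‖x‖ / 2) ^ (2 * s - n)) :=
            setLIntegral_le_lintegral _ _
        _ ≤ ENNReal.ofReal C₁ *
            ENNReal.ofReal (l ^ (-1 - τ) * (‖x‖ / 2) ^ (2 * s - n)) := by
            rw [lintegral_mul_const' _ _ ENNReal.ofReal_ne_top]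
            gcongr
            exact h₁ x _ hlt
        _ = _ := by
            rw [← ENNReal.ofReal_mul hC₁.le, hhalf]
            congr 1; ring
    refine (add_le_add hin hout).trans_eq ?_
    rw [← ENNReal.ofReal_add (by positivity) (by positivity),
      ← ENNReal.ofReal_mul (by positivity), hd]
    congr 1; ring
  calc Tout n s G x t ≤ ∫⁻ l in Ioi t,
        ENNReal.ofReal (d * ‖x‖ ^ (2 * s - n)) * ENNReal.ofReal (l ^ (-1 - τ)) :=
        setLIntegral_mono' measurableSet_Ioi fun l hl => hslice l hl
    _ = _ := by
        rw [lintegral_const_mul' _ _ ENNReal.ofReal_ne_top,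
          lintegral_Ioi_rpow (by linarith) ht, ← ENNReal.ofReal_mul (by positivity)]
        congr 1
        have : -1 - τ + 1 = -τ := by ring
        rw [this]
        field_simp

end WeightProfiles

/-! ### The individual weights. -/

section Weights

variable (n : ℕ) {s : ℝ}

lemma IsPow.one : IsPow (fun _ => 1) 0 := ⟨1, one_pos, fun t _ => by simp⟩

/-- The bound for `ω_{2,j}`. -/
lemma Tout_w2_le (hs : 0 < s) (hn : 6 * s < n) {σ : ℝ} (hσ : 0 < σ) (δ : ℝ) {j : ℕ}
    (hj : 2 ≤ j) :
    ∃ C : ℝ, 0 < C ∧ ∀ (x : EuclideanSpace ℝ (Fin n)) (t : ℝ), 1 < t →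
      Tout n s (w2 n s σ δ j) x t ≤ ENNReal.ofReal (C * w2Star n s σ δ j x t) := by
  have hn1 : 1 ≤ n := by
    have : (0 : ℝ) < n := by linarith
    exact_mod_cast this
  have a₁ := aExp_nonneg n hs hn (show 1 ≤ j - 1 by omega)
  have a₂ := aExp_nonneg n hs hn (show 1 ≤ j by omega)
  have a₃ := aExp_mono n hs hn (show j ≤ j + 1 by omega)
  have hA : IsPow (fun t => t ^ (-σ) * mu n s (j + 1) t ^ ((n : ℝ) / 2 - 2 * s)
      * mu n s j t ^ (-s)) _ :=
    ((IsPow.id_rpow (-σ)).mul ((isPow_mu n hs hn (j + 1)).rpow _)).mul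
      ((isPow_mu n hs hn j).rpow _)
  have hR₁ := isPow_muBar n hs hn δ (show 2 ≤ j + 1 by omega)
  have hR₂ := isPow_muBar n hs hn δ hj
  -- The coefficient is nonincreasing because `n > 6s` gives `s ≤ n/2 - 2s`: the decay of
  -- `μ_{0,j+1}^(n/2-2s)` beats the growth of `μ_{0,j}^(-s)`.
  obtain ⟨C, hC, h⟩ := annulus_weight_bound n hn1 hs (by linarith) hA (by
      have h1 : s ≤ (n : ℝ) / 2 - 2 * s := by linarith
      have h2 : aExp n s j * s ≤ aExp n s (j + 1) * ((n : ℝ) / 2 - 2 * s) := by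
        gcongr; exact a₂.trans a₃
      nlinarith) hR₁ (by rw [Nat.add_sub_cancel]; linarith) hR₂ (by linarith)
    (G := w2 n s σ δ j) fun y l => rfl
  refine ⟨C, hC, fun x t ht => ?_⟩
  obtain ⟨h₁, h₂, h₃⟩ := h x t ht
  have ht0 : 0 < t := by linarith
  have m₁ := (isPow_mu n hs hn (j + 1)).pos ht0
  have m₂ := (isPow_mu n hs hn j).pos ht0
  have m₃ := (isPow_mu n hs hn (j - 1)).pos ht0
  unfold w2Star
  split_ifs with c₁ c₂
  · convert h₁ using 3
    have e : (4 * s - n : ℝ) = 2 * (2 * s - n / 2) := by ring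
    rw [e, muBar_rpow n hs hn δ _ (show 2 ≤ j + 1 by omega) ht0, Nat.add_sub_cancel]
    have e1 : mu n s (j + 1) t ^ ((n : ℝ) / 2 - 2 * s) * mu n s (j + 1) t ^ (2 * s - (n : ℝ) / 2)
        = 1 := by
      rw [← Real.rpow_add m₁, ← Real.rpow_zero (mu n s (j + 1) t)]; congr 1; ring
    have e2 : mu n s j t ^ (s - (n : ℝ) / 2)
        = mu n s j t ^ (-s) * mu n s j t ^ (2 * s - (n : ℝ) / 2) := by
      rw [← Real.rpow_add m₂]; congr 1; ring
    rw [e2]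
    linear_combination (-(t ^ (-σ) * mu n s j t ^ (-s) * mu n s j t ^ (2 * s - (n : ℝ) / 2))) * e1
  · exact h₂ (norm_pos_iff.1 ((hR₁.pos ht0).trans (not_le.1 c₁)))
  · convert h₃ (norm_pos_iff.1 ((hR₁.pos ht0).trans (not_le.1 c₁))) using 4
    rw [muBar_rpow n hs hn δ s hj ht0]
    have e1 : mu n s j t ^ (-s) * mu n s j t ^ s = 1 := by
      rw [← Real.rpow_add m₂, ← Real.rpow_zero (mu n s j t)]; congr 1; ring
    linear_combination
      (-(t ^ (-σ) * mu n s (j + 1) t ^ ((n : ℝ) / 2 - 2 * s) * mu n s (j - 1) t ^ s)) * e1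

/-- The bound for `ω_{2,1}`. -/
lemma Tout_w21_le (hs : 0 < s) (hn : 6 * s < n) {σ : ℝ} (hσ : 0 < σ) (δ : ℝ) :
    ∃ C : ℝ, 0 < C ∧ ∀ (x : EuclideanSpace ℝ (Fin n)) (t : ℝ), 1 < t →
      Tout n s (w21 n s σ δ) x t ≤ ENNReal.ofReal (C * w21Star n s σ δ x t) := by
  have hn1 : 1 ≤ n := by
    have : (0 : ℝ) < n := by linarith
    exact_mod_cast this
  have a₂ := aExp_nonneg n hs hn (show 1 ≤ 2 by omega)
  have hA : IsPow (fun t => t ^ (-σ) * mu n s 2 t ^ ((n : ℝ) / 2 - 2 * s)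
      * mu n s 1 t ^ (-s)) _ :=
    ((IsPow.id_rpow (-σ)).mul ((isPow_mu n hs hn 2).rpow _)).mul ((isPow_mu n hs hn 1).rpow _)
  have hR₁ := isPow_muBar n hs hn δ le_rfl
  obtain ⟨C, hC, h⟩ := annulus_weight_bound n hn1 hs (by linarith) hA (by
      rw [aExp_one]
      nlinarith) hR₁ (by simp only [Nat.add_one_sub_one, aExp_one]; linarith) IsPow.one le_rfl
    (G := w21 n s σ δ) fun y l => rfl
  refine ⟨C, hC, fun x t ht => ?_⟩
  obtain ⟨h₁, h₂, h₃⟩ := h x t ht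
  have ht0 : 0 < t := by linarith
  have m₁ := hR₁.pos ht0
  -- As `μ_{0,1} = 1`, the scale `μ̄_{0,2}` is `√μ_{0,2}`.
  have hb : t ^ (-σ) * mu n s 2 t ^ ((n : ℝ) / 2 - 2 * s) * mu n s 1 t ^ (-s)
      = t ^ (-σ) * muBar n s δ 2 t ^ ((n : ℝ) - 4 * s) := by
    have e : (n - 4 * s : ℝ) = 2 * (n / 2 - 2 * s) := by ring
    rw [e, muBar_rpow n hs hn δ _ le_rfl ht0, Nat.add_one_sub_one, mu_one, Real.one_rpow,
      Real.one_rpow, mul_one, mul_one]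
  rw [hb] at h₁ h₂ h₃
  unfold w21Star
  split_ifs with c₁ c₂
  · convert h₁ using 3
    rw [mul_assoc, ← Real.rpow_add m₁]
    simp
  · exact h₂ (norm_pos_iff.1 (m₁.trans (not_le.1 c₁)))
  · simpa using h₃ (norm_pos_iff.1 (m₁.trans (not_le.1 c₁)))

/-- The bound for `ω_{1,j}'`. -/
lemma Tout_w1'_le (hs : 0 < s) (hn : 6 * s < n) {σ : ℝ} (hσ : 0 < σ) (δ : ℝ) {j : ℕ}
    (hj : 2 ≤ j) :
    ∃ C : ℝ, 0 < C ∧ ∀ (x : EuclideanSpace ℝ (Fin n)) (t : ℝ), 1 < t →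
      Tout n s (w1' n s σ δ j) x t ≤ ENNReal.ofReal (C * w1'Star n s σ δ j x t) := by
  have hn1 : 1 ≤ n := by
    have : (0 : ℝ) < n := by linarith
    exact_mod_cast this
  have a₁ := aExp_nonneg n hs hn (show 1 ≤ j - 1 by omega)
  have a₂ := aExp_mono n hs hn (show j - 1 ≤ j by omega)
  have hA : IsPow (fun t => mu n s j t ^ (n : ℝ) * t ^ gam n s σ j) _ :=
    ((isPow_mu n hs hn j).rpow _).mul (IsPow.id_rpow _)
  have hR := isPow_muBar n hs hn δ hj
  have hg := gam_of_two_le n s σ hj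
  obtain ⟨C, hC, h⟩ := tail_weight_bound n hn1 hs (by linarith) hA (by rw [hg]; nlinarith) hR
    (by linarith) (by rw [hg]; nlinarith) (G := w1' n s σ δ j) fun y l => rfl
  refine ⟨C, hC, fun x t ht => ?_⟩
  obtain ⟨h₁, h₂⟩ := h x t ht
  unfold w1'Star
  split_ifs with c₁
  · exact h₁
  · exact h₂ (not_le.1 c₁).le

/-- The bound for `ω_{1,j}''`. -/
lemma Tout_w1''_le (hs : 0 < s) (hn : 6 * s < n) {σ : ℝ} (hσ : 0 < σ) (δ : ℝ) {j : ℕ}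
    (hj : 2 ≤ j) :
    ∃ C : ℝ, 0 < C ∧ ∀ (x : EuclideanSpace ℝ (Fin n)) (t : ℝ), 1 < t →
      Tout n s (w1'' n s σ δ j) x t ≤ ENNReal.ofReal (C * w1''Star n s σ δ j x t) := by
  have hn1 : 1 ≤ n := by
    have : (0 : ℝ) < n := by linarith
    exact_mod_cast this
  have a₁ := aExp_nonneg n hs hn (show 1 ≤ j - 1 by omega)
  have a₂ := aExp_mono n hs hn (show j - 1 ≤ j by omega)
  have hR := isPow_muBar n hs hn δ hj
  have hA : IsPow (fun t => muBar n s δ j t ^ (n : ℝ) * t ^ gam n s σ j) _ :=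
    (hR.rpow _).mul (IsPow.id_rpow _)
  have hg := gam_of_two_le n s σ hj
  obtain ⟨C, hC, h⟩ := tail_weight_bound n hn1 hs (by linarith) hA (by rw [hg]; nlinarith) hR
    (by linarith) (by rw [hg]; nlinarith) (G := w1'' n s σ δ j) fun y l => rfl
  refine ⟨C, hC, fun x t ht => ?_⟩
  obtain ⟨h₁, h₂⟩ := h x t ht
  have m := hR.pos (show 0 < t by linarith)
  unfold w1''Star
  split_ifs with c₁
  · convert h₁ using 3
    rw [mul_right_comm, ← Real.rpow_add m]
    simp
  · convert h₂ (not_le.1 c₁).le using 4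
    rw [mul_right_comm, ← Real.rpow_add m, ← sub_eq_add_neg]

/-- The bound for `ω_{1,j}`. -/
lemma Tout_w1_le (hs : 0 < s) (hn : 6 * s < n) {α σ : ℝ} (hα : 0 < α) (hαs : α < s)
    (hσ : 0 < σ) (δ : ℝ) {j : ℕ} (hj : 2 ≤ j) :
    ∃ C : ℝ, 0 < C ∧ ∀ (x : EuclideanSpace ℝ (Fin n)) (t : ℝ), 1 < t →
      Tout n s (w1 n s α σ δ j) x t ≤ ENNReal.ofReal (C * w1Star n s α σ δ j x t) := by
  have hn1 : 1 ≤ n := by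
    have : (0 : ℝ) < n := by linarith
    exact_mod_cast this
  have a₁ := aExp_nonneg n hs hn (show 1 ≤ j - 1 by omega)
  have a₂ := aExp_mono n hs hn (show j - 1 ≤ j by omega)
  have hμ := isPow_mu n hs hn j
  have hρ := isPow_muBar n hs hn δ hj
  have hg := gam_of_two_le n s σ hj
  have hK : IsPow (fun t => t ^ (-σ) / mu n s j t ^ (((n : ℝ) + 2 * s) / 2)
      * lam n s j t ^ (((n : ℝ) - 2 * s) / 2)) _ :=
    ((IsPow.id_rpow (-σ)).div (hμ.rpow _)).mul ((hμ.div (isPow_mu n hs hn (j - 1))).rpow _)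
  -- `K μ_{0,j}^(2s)` equals `t^(-σ) μ_{0,j-1}^(-(n-2s)/2)`, a constant multiple of `t^γ_j`; this is
  -- the source of the exponent `γ_j`.
  obtain ⟨c, hc, hceq⟩ := ((hK.mul (hμ.rpow (2 * s))).div (IsPow.id_rpow (gam n s σ j))).eq_const
    (by rw [hg]; ring)
  set K : ℝ → ℝ := fun t => t ^ (-σ) / mu n s j t ^ (((n : ℝ) + 2 * s) / 2)
      * lam n s j t ^ (((n : ℝ) - 2 * s) / 2) with hKdef
  have hG : ∀ y l, w1 n s α σ δ j y l = K l / (1 + (‖y‖ / mu n s j l) ^ (2 * s + α))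
      * ind (‖y‖ ≤ 2 * muBar n s δ j l) := by
    intro y l
    rw [hKdef, w1]
    ring
  -- After simplification the left side is `-σ` minus half of `p1` and half of `p2`.
  have he : -σ - -aExp n s j * (((n : ℝ) + 2 * s) / 2)
      + (-aExp n s j - -aExp n s (j - 1)) * (((n : ℝ) - 2 * s) / 2)
      + -aExp n s j * (2 * s + α)
      + (-aExp n s j + -aExp n s (j - 1)) / 2 * (n - (2 * s + α)) ≤ 0 := by
    have p1 : 0 ≤ aExp n s j * ((n : ℝ) - 2 * s) := mul_nonneg (by linarith) (by linarith)
    have p2 : 0 ≤ α * (aExp n s j - aExp n s (j - 1)) := mul_nonneg hα.le (by linarith)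
    nlinarith
  obtain ⟨C₁, hC₁, h₁⟩ := core_weight_bound n hn1 hs (by linarith) (by linarith) (by linarith)
    hK hμ hρ he hG
  obtain ⟨C₂, hC₂, h₂⟩ := core_weight_decay n hn1 hs (by linarith) (by linarith) (by linarith)
    hK hμ hρ he hG
  -- This bounds the late-time mass term by a multiple of `t^γ_j` near the origin.
  obtain ⟨D, hD, hbd⟩ := ((hμ.rpow α).mul (hρ.rpow ((n : ℝ) - 2 * s - α))).bounded (by
    have p1 : 0 ≤ aExp n s j * α := mul_nonneg (by linarith) hα.le
    have p2 : 0 ≤ (aExp n s j + aExp n s (j - 1)) * ((n : ℝ) - 2 * s - α) :=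
      mul_nonneg (by linarith) (by linarith)
    linarith)
  refine ⟨C₁ * (c * (1 + D)) + C₂ * c, by positivity, fun x t ht => ?_⟩
  have ht0 : 0 < t := by linarith
  have hμt := hμ.pos ht0
  have hρt := hρ.pos ht0
  have e1 : K t * mu n s j t ^ (2 * s) = c * t ^ gam n s σ j := by
    rw [← hceq t ht0, div_mul_cancel₀ _ (by positivity)]
  have e2 : K t * mu n s j t ^ (2 * s + α) * muBar n s δ j t ^ ((n : ℝ) - (2 * s + α))
      = c * (t ^ gam n s σ j * mu n s j t ^ α * muBar n s δ j t ^ ((n : ℝ) - 2 * s - α)) := by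
    rw [Real.rpow_add hμt, ← mul_assoc, e1, sub_sub]; ring
  unfold w1Star
  split_ifs with c₁
  · refine (h₁ x t ht).trans (ENNReal.ofReal_le_ofReal ?_)
    rw [e1, e2]
    have hb := hbd t ht.le
    calc _ = C₁ * (c * (1 + mu n s j t ^ α * muBar n s δ j t ^ ((n : ℝ) - 2 * s - α)))
            * t ^ gam n s σ j := by ring
      _ ≤ C₁ * (c * (1 + D)) * t ^ gam n s σ j := by gcongr
      _ ≤ _ := by
        gcongr
        have : 0 < C₂ * c := by positivity
        linarith
  · have hx0 : 0 < ‖x‖ := (show 0 < 4 * muBar n s δ j t by positivity).trans (not_le.1 c₁)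
    refine ((h₂ t ht).2 x (norm_pos_iff.1 hx0)).trans (ENNReal.ofReal_le_ofReal ?_)
    rw [e2]
    calc _ = C₂ * c * (t ^ gam n s σ j * mu n s j t ^ α
            * muBar n s δ j t ^ ((n : ℝ) - 2 * s - α) * ‖x‖ ^ (2 * s - (n : ℝ))) := by ring
      _ ≤ _ := by
        gcongr
        have : 0 < C₁ * (c * (1 + D)) := by positivity
        linarith

/-- The restriction on `δ` makes the relevant time exponent negative. -/
lemma time_exponent_neg (hn : 6 * s < n) {α σ δ : ℝ} (hα : 0 < α)
    (hδ : 0 < δ) (hσ1 : σ < 1) (hδσ : δ * ((n : ℝ) - 4 * s) < σ) :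
    δ * (2 * s) < 1 ∧ -1 - σ + δ * ((n : ℝ) - 2 * s - α) < 0 := by
  -- Since `n - 4s > 2s`, one has `2sδ < δ(n-4s) < σ < 1`.
  have h1 : δ * (2 * s) < 1 := by nlinarith
  have h2 : 0 < δ * α := by positivity
  exact ⟨h1, by nlinarith⟩

/-- The bound for `ω_{1,1}`. -/
lemma Tout_w11_le (hs : 0 < s) (hn : 6 * s < n) {α σ δ : ℝ} (hα : 0 < α) (hαs : α < s)
    (hσ : 0 < σ) (hσ1 : σ < 1) (hδ : 0 < δ) (hδσ : δ * ((n : ℝ) - 4 * s) < σ) :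
    ∃ C : ℝ, 0 < C ∧ ∀ (x : EuclideanSpace ℝ (Fin n)) (t : ℝ), 1 < t →
      Tout n s (w11 n s α σ δ) x t ≤ ENNReal.ofReal (C * w11Star n s α σ δ x t) := by
  have hn1 : 1 ≤ n := by
    have : (0 : ℝ) < n := by linarith
    exact_mod_cast this
  have hexp := (time_exponent_neg n hn hα hδ hσ1 hδσ).2
  have hG : ∀ y l, w11 n s α σ δ y l = l ^ (-1 - σ) / (1 + (‖y‖ / 1) ^ (2 * s + α))
      * ind (‖y‖ ≤ 2 * l ^ δ) := by
    intro y l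
    rw [w11, muBar_one, div_one]
  obtain ⟨C₀, hC₀, h₀⟩ := setLIntegral_le_of_le_rpow n hn1 (c := 2 * s + α) (by linarith)
  obtain ⟨C₁, hC₁, h₁⟩ := Tout_le_of_stationary n hn1 hs (by linarith)
    (show 2 * s < 2 * s + α by linarith)
  obtain ⟨C₂, hC₂, h₂⟩ := Tout_le_of_mass n hn1 hs (by linarith)
    (show 2 * s < 2 * s + α by linarith)
  obtain ⟨C₃, hC₃, h₃⟩ := core_weight_decay n hn1 hs (by linarith) (a := 2 * s + α) (by linarith)
    (by linarith) (IsPow.id_rpow (-1 - σ)) IsPow.one (IsPow.id_rpow δ) (by linarith) hG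
  set k₂ : ℝ := C₂ * (C₀ * (1 / 2) ^ ((n : ℝ) - (2 * s + α)) + 1) with hk₂
  have hk₂' : 0 < k₂ := by positivity
  refine ⟨C₁ + k₂ + C₃, by positivity, fun x t ht => ?_⟩
  have ht0 : 0 < t := by linarith
  have hle : ∀ l, t < l → ∀ y, |w11 n s α σ δ y l|
      ≤ t ^ (-1 - σ) * max 1 ‖y‖ ^ (-(2 * s + α)) := by
    intro l hl y
    rw [hG]
    have hl0 : 0 < l := ht0.trans hl
    refine (core_weight_le (by positivity) one_pos y).trans ?_
    rw [Real.one_rpow, mul_one]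
    gcongr ?_ * ?_
    exact Real.rpow_le_rpow_of_nonpos ht0 hl.le (by linarith)
  have hle' : ∀ l, t < l → ∀ y, y ≠ 0 → |w11 n s α σ δ y l|
      ≤ t ^ (-1 - σ) * ‖y‖ ^ (-(2 * s + α)) := by
    intro l hl y hy
    refine (hle l hl y).trans ?_
    gcongr ?_ * ?_
    exact Real.rpow_le_rpow_of_nonpos (norm_pos_iff.2 hy) (le_max_right _ _) (by linarith)
  unfold w11Star
  rw [gam_one, muBar_one]
  split_ifs with c₁ c₂
  · refine (h₁ _ x t 1 (t ^ (-1 - σ)) one_pos (by positivity) hle).trans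
      (ENNReal.ofReal_le_ofReal ?_)
    rw [Real.one_rpow, mul_one]
    gcongr
    linarith
  · have hx0 : 0 < ‖x‖ := by linarith
    refine (h₂ _ x t (C₀ * (t ^ (-1 - σ) * (‖x‖ / 2) ^ ((n : ℝ) - (2 * s + α)))) (t ^ (-1 - σ))
      (norm_pos_iff.1 hx0) (by positivity) (by positivity)
      (fun l hl y hy => hle' l hl y (norm_pos_iff.1 (by linarith)))
      fun l hl => h₀ _ _ _ (by positivity) (by positivity) (hle' l hl)).trans
      (ENNReal.ofReal_le_ofReal ?_)
    have e1 : 2 * s - (2 * s + α) = -α := by ring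
    have e2 : (‖x‖ / 2) ^ ((n : ℝ) - (2 * s + α)) * ‖x‖ ^ (2 * s - n)
        = (1 / 2) ^ ((n : ℝ) - (2 * s + α)) * ‖x‖ ^ (-α) := by
      rw [show ‖x‖ / 2 = 1 / 2 * ‖x‖ by ring, Real.mul_rpow (by positivity) (by positivity),
        mul_assoc, ← Real.rpow_add hx0]
      congr 2; ring
    rw [e1]
    calc _ = k₂ * (t ^ (-1 - σ) * ‖x‖ ^ (-α)) := by
          rw [hk₂]; linear_combination C₂ * C₀ * t ^ (-1 - σ) * e2
      _ ≤ _ := by gcongr; linarith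
  · have hx0 : 0 < ‖x‖ := by linarith
    refine ((h₃ t ht).2 x (norm_pos_iff.1 hx0)).trans (ENNReal.ofReal_le_ofReal ?_)
    have e1 : t ^ (-1 - σ) * 1 ^ (2 * s + α) * (t ^ δ) ^ ((n : ℝ) - (2 * s + α))
        = t ^ (-1 - σ + δ * ((n : ℝ) - 2 * s - α)) := by
      rw [Real.one_rpow, mul_one, ← Real.rpow_mul ht0.le, ← Real.rpow_add ht0, sub_sub]
    rw [e1]
    gcongr
    linarith

/-- The bound for `ω_{1,1}'`. -/
lemma Tout_w11'_le (hs : 0 < s) (hn : 6 * s < n) {α σ δ : ℝ} (hα : 0 < α) (hαs : α < s)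
    (hσ1 : σ < 1) (hδ : 0 < δ) (hδσ : δ * ((n : ℝ) - 4 * s) < σ) :
    ∃ C : ℝ, 0 < C ∧ ∀ (x : EuclideanSpace ℝ (Fin n)) (t : ℝ), 1 < t →
      Tout n s (w11' n s α σ δ) x t ≤ ENNReal.ofReal (C * w11'Star n s α σ δ x t) := by
  have hn1 : 1 ≤ n := by
    have : (0 : ℝ) < n := by linarith
    exact_mod_cast this
  obtain ⟨hδ1, hexp⟩ := time_exponent_neg n hn hα hδ hσ1 hδσ
  set E : ℝ := -1 - σ + δ * ((n : ℝ) - 2 * s - α) with hE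
  obtain ⟨C₀, hC₀, h₀⟩ := lintegral_le_of_le_max n hs
  obtain ⟨C₁, hC₁, h₁⟩ := Tout_le_of_stationary n hn1 hs (by linarith)
    (show 2 * s < n + s by linarith)
  obtain ⟨C₂, hC₂, h₂⟩ := Tout_le_of_mass n hn1 hs (by linarith)
    (show 2 * s < n + s by linarith)
  refine ⟨C₁ * 2 + C₂ * (C₀ * 2 + 2), by positivity, fun x t ht => ?_⟩
  have ht0 : 0 < t := by linarith
  -- The inner radius `l^δ` grows with time, so one stationary majorant serves for all `l > t`. The
  -- far piece fits under the same rate `n + s` because `|y| ≥ 1` there and `l^(-1-σ) ≤ l^E`.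
  have hle : ∀ l, t < l → ∀ y, |w11' n s α σ δ y l|
      ≤ 2 * t ^ E * max (t ^ δ) ‖y‖ ^ (-(n + s)) := by
    intro l hl y
    have hl0 : 0 < l := ht0.trans hl
    have hl1 : 1 < l := ht.trans hl
    have hEl : l ^ E ≤ t ^ E := Real.rpow_le_rpow_of_nonpos ht0 hl.le hexp.le
    have htl : t ^ δ ≤ l ^ δ := Real.rpow_le_rpow ht0.le hl.le hδ.le
    have hEeq : l ^ (-1 - σ) * (l ^ δ) ^ ((n : ℝ) - 2 * s - α) = l ^ E := by
      rw [← Real.rpow_mul hl0.le, ← Real.rpow_add hl0]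
    have hlδ : l ^ δ ≤ l ^ (1 / (2 * s)) := by
      refine Real.rpow_le_rpow_of_exponent_le hl1.le ?_
      rw [le_div_iff₀ (by positivity)]; exact hδ1.le
    have hm : 0 < max (t ^ δ) ‖y‖ := lt_max_of_lt_left (by positivity)
    have p : 0 ≤ t ^ E * max (t ^ δ) ‖y‖ ^ (-(n + s)) := by positivity
    rw [w11', gam_one, muBar_one, hEeq]
    have b₁ : |l ^ E * ‖y‖ ^ (-s - (n : ℝ)) * ind (l ^ δ ≤ ‖y‖ ∧ ‖y‖ ≤ l ^ (1 / (2 * s)))|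
        ≤ t ^ E * max (t ^ δ) ‖y‖ ^ (-(n + s)) := by
      by_cases hy : l ^ δ ≤ ‖y‖ ∧ ‖y‖ ≤ l ^ (1 / (2 * s))
      · rw [ind_of hy, mul_one, abs_of_nonneg (by positivity), max_eq_right (htl.trans hy.1),
          show -s - (n : ℝ) = -(n + s) by ring]
        gcongr
      · rw [ind_of_not hy, mul_zero, abs_zero]; exact p
    have b₂ : |l ^ (-1 - σ) * ‖y‖ ^ (-(n : ℝ) - 2 * s) * ind (l ^ (1 / (2 * s)) ≤ ‖y‖)|
        ≤ t ^ E * max (t ^ δ) ‖y‖ ^ (-(n + s)) := by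
      by_cases hy : l ^ (1 / (2 * s)) ≤ ‖y‖
      · have hy1 : 1 ≤ ‖y‖ :=
          (Real.one_le_rpow hl1.le (by positivity)).trans hy
        have q₁ : l ^ (-1 - σ) ≤ l ^ E :=
          Real.rpow_le_rpow_of_exponent_le hl1.le (by
            have : 0 ≤ δ * ((n : ℝ) - 2 * s - α) := mul_nonneg hδ.le (by linarith)
            linarith)
        rw [ind_of hy, mul_one, abs_of_nonneg (by positivity),
          max_eq_right (htl.trans (hlδ.trans hy))]
        have q₂ : ‖y‖ ^ (-(n : ℝ) - 2 * s) ≤ ‖y‖ ^ (-((n : ℝ) + s)) :=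
          Real.rpow_le_rpow_of_exponent_le hy1 (by linarith)
        have q₃ := q₁.trans hEl
        gcongr
      · rw [ind_of_not hy, mul_zero, abs_zero]; exact p
    refine (abs_add_le _ _).trans ?_
    linarith
  have hR : 0 < t ^ δ := by positivity
  unfold w11'Star
  rw [gam_one, muBar_one]
  split_ifs with c₁
  · refine (h₁ _ x t (t ^ δ) (2 * t ^ E) hR (by positivity) hle).trans
      (ENNReal.ofReal_le_ofReal ?_)
    have e1 : t ^ E * (t ^ δ) ^ (2 * s - (n + s)) = t ^ (-1 - σ - δ * (s + α)) := by
      rw [← Real.rpow_mul ht0.le, ← Real.rpow_add ht0, hE]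
      congr 1; ring
    calc _ = C₁ * 2 * (t ^ E * (t ^ δ) ^ (2 * s - (n + s))) := by ring
      _ = C₁ * 2 * t ^ (-1 - σ - δ * (s + α)) := by rw [e1]
      _ ≤ _ := by
        gcongr
        have : 0 < C₂ * (C₀ * 2 + 2) := by positivity
        linarith
  · have hxR : t ^ δ < ‖x‖ := not_le.1 c₁
    have hx0 : 0 < ‖x‖ := hR.trans hxR
    refine (h₂ _ x t (C₀ * (2 * t ^ E * (t ^ δ) ^ (-s))) (2 * t ^ E) (norm_pos_iff.1 hx0)
      (by positivity) (by positivity) (fun l hl y hy => (hle l hl y).trans ?_)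
      fun l hl => (setLIntegral_le_lintegral _ _).trans
        (h₀ _ _ _ hR (by positivity) fun y => ?_)).trans
      (ENNReal.ofReal_le_ofReal ?_)
    · gcongr ?_ * ?_
      exact Real.rpow_le_rpow_of_nonpos (by linarith) (le_max_right _ _) (by linarith)
    · rw [← neg_add']; exact hle l hl y
    · have e1 : t ^ E * (t ^ δ) ^ (-s) = t ^ (-1 - σ + ((n : ℝ) - 3 * s - α) * δ) := by
        rw [← Real.rpow_mul ht0.le, ← Real.rpow_add ht0, hE]
        congr 1; ring
      have e2 : ‖x‖ ^ (2 * s - (n + s)) ≤ (t ^ δ) ^ (-s) * ‖x‖ ^ (2 * s - n) := by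
        calc _ = ‖x‖ ^ (-s) * ‖x‖ ^ (2 * s - n) := by
              rw [← Real.rpow_add hx0]; congr 1; ring
          _ ≤ _ := by
              gcongr ?_ * _
              exact Real.rpow_le_rpow_of_nonpos hR hxR.le (by linarith)
      calc _ ≤ C₂ * (C₀ * (2 * t ^ E * (t ^ δ) ^ (-s)) * ‖x‖ ^ (2 * s - n)
              + 2 * t ^ E * ((t ^ δ) ^ (-s) * ‖x‖ ^ (2 * s - n))) := by gcongr
        _ = C₂ * (C₀ * 2 + 2) * ((t ^ E * (t ^ δ) ^ (-s)) * ‖x‖ ^ (2 * s - n)) := by ring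
        _ ≤ _ := by
          rw [e1]
          gcongr
          have : 0 < C₁ * 2 := by positivity
          linarith

/-- The bound for `ω_3`. -/
lemma Tout_w3_le (hs : 0 < s) (hn : 6 * s < n) {σ δ : ℝ} (hδ : 0 < δ)
    (hδσ : δ * ((n : ℝ) - 4 * s) < σ) :
    ∃ C : ℝ, 0 < C ∧ ∀ (x : EuclideanSpace ℝ (Fin n)) (t : ℝ), 1 < t →
      Tout n s (w3 n s σ δ) x t ≤ ENNReal.ofReal (C * w3Star n s σ δ x t) := by
  have hn1 : 1 ≤ n := by
    have : (0 : ℝ) < n := by linarith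
    exact_mod_cast this
  -- The combined time factor of `ω_3` is `l^(-1-τ)`, and the restriction on `δ` says exactly that
  -- `τ > 0`.
  set τ : ℝ := σ - δ * ((n : ℝ) - 4 * s) with hτ
  have hτ0 : 0 < τ := by linarith
  obtain ⟨C₀, hC₀, h₀⟩ := setLIntegral_le_of_le_rpow n hn1 (c := n - 2 * s) (by linarith)
  obtain ⟨C₁, hC₁, h₁⟩ := Tout_le_of_stationary n hn1 hs (by linarith)
    (show 2 * s < n - 2 * s by linarith)
  obtain ⟨C₂, hC₂, h₂⟩ := Tout_le_of_mass n hn1 hs (by linarith)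
    (show 2 * s < n - 2 * s by linarith)
  obtain ⟨C₃, hC₃, h₃⟩ := Tout_le_of_time_decay n hn1 hs (by linarith) hτ0
  set k₂ : ℝ := C₂ * (C₀ * (1 / 2) ^ (2 * s) + 1) with hk₂
  have hk₂' : 0 < k₂ := by positivity
  refine ⟨C₁ + k₂ + C₃, by positivity, fun x t ht => ?_⟩
  have ht0 : 0 < t := by linarith
  have hw : ∀ l, 0 < l → ∀ y, w3 n s σ δ y l
      = l ^ (-1 - τ) * ‖y‖ ^ (2 * s - (n : ℝ)) * ind (l ^ δ ≤ ‖y‖) := by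
    intro l hl y
    rw [w3, muBar_one, ← Real.rpow_add hl, hτ]
    congr 3; ring
  have hδ0 : ∀ l, t < l → ∀ y, |w3 n s σ δ y l| ≤ l ^ (-1 - τ) * ‖y‖ ^ (2 * s - (n : ℝ)) := by
    intro l hl y
    have hl0 : 0 < l := ht0.trans hl
    rw [hw l hl0]
    by_cases hy : l ^ δ ≤ ‖y‖
    · rw [ind_of hy, mul_one, abs_of_nonneg (by positivity)]
    · rw [ind_of_not hy, mul_zero, abs_zero]; positivity
  have hle' : ∀ l, t < l → ∀ y, |w3 n s σ δ y l|
      ≤ t ^ (-1 - τ) * ‖y‖ ^ (-((n : ℝ) - 2 * s)) := by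
    intro l hl y
    refine (hδ0 l hl y).trans ?_
    rw [neg_sub]
    gcongr ?_ * _
    exact Real.rpow_le_rpow_of_nonpos ht0 hl.le (by linarith)
  have hτt : t ^ (δ * ((n : ℝ) - 4 * s)) * t ^ (-1 - σ) = t ^ (-1 - τ) := by
    rw [← Real.rpow_add ht0, hτ]; congr 1; ring
  have hτt' : t ^ (δ * ((n : ℝ) - 4 * s)) * t ^ (-σ) = t ^ (-τ) := by
    rw [← Real.rpow_add ht0, hτ]; congr 1; ring
  have e1 : 2 * s - (n - 2 * s) = 4 * s - n := by ring
  have hR : 0 < t ^ δ := by positivity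
  unfold w3Star
  rw [muBar_one]
  split_ifs with c₁ c₂
  · rw [← mul_assoc (t ^ _), hτt]
    refine (h₁ _ x t (t ^ δ) (t ^ (-1 - τ)) hR (by positivity) fun l hl y => ?_).trans
      (ENNReal.ofReal_le_ofReal ?_)
    · rcases le_or_gt (t ^ δ) ‖y‖ with h | h
      · rw [max_eq_right h]; exact hle' l hl y
      · have hl0 : 0 < l := ht0.trans hl
        have htl : t ^ δ ≤ l ^ δ := Real.rpow_le_rpow ht0.le hl.le hδ.le
        rw [hw l hl0, ind_of_not (not_le.2 (h.trans_le htl)), mul_zero, abs_zero]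
        positivity
    · rw [e1]
      gcongr
      linarith
  · have hx0 : 0 < ‖x‖ := hR.trans (not_le.1 c₁)
    rw [← mul_assoc (t ^ _), hτt]
    refine (h₂ _ x t (C₀ * (t ^ (-1 - τ) * (‖x‖ / 2) ^ ((n : ℝ) - (n - 2 * s)))) (t ^ (-1 - τ))
      (norm_pos_iff.1 hx0) (by positivity) (by positivity) (fun l hl y _ => hle' l hl y)
      fun l hl => h₀ _ _ _ (by positivity) (by positivity) fun y _ => hle' l hl y).trans
      (ENNReal.ofReal_le_ofReal ?_)
    have e2 : (‖x‖ / 2) ^ ((n : ℝ) - (n - 2 * s)) * ‖x‖ ^ (2 * s - n)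
        = (1 / 2) ^ (2 * s) * ‖x‖ ^ (4 * s - n) := by
      rw [sub_sub_cancel, show ‖x‖ / 2 = 1 / 2 * ‖x‖ by ring,
        Real.mul_rpow (by positivity) (by positivity), mul_assoc, ← Real.rpow_add hx0]
      congr 2; ring
    rw [e1]
    calc _ = k₂ * (t ^ (-1 - τ) * ‖x‖ ^ (4 * s - n)) := by
          rw [hk₂]; linear_combination C₂ * C₀ * t ^ (-1 - τ) * e2
      _ ≤ _ := by gcongr; linarith
  · have hx0 : 0 < ‖x‖ := hR.trans (not_le.1 c₁)
    rw [← mul_assoc (t ^ _), hτt']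
    -- Beyond `t^(1/(2s))` the factor `t^(-1) |x|^(2s)` exceeds `1`, so the mass estimate of the
    -- previous case would be too weak; integrability in time gives `t^(-τ)` instead.
    refine (h₃ _ x t ht0 (norm_pos_iff.1 hx0) hδ0).trans (ENNReal.ofReal_le_ofReal ?_)
    gcongr
    linarith

end Weights

/-! ### A common constant, and conclusion. -/

/-- For `S ≤ 0` the left side is `0`, so constants can be enlarged without checking that the
bounding functions are nonnegative. -/
lemma ofReal_mul_le_ofReal_mul {C C' S : ℝ} (hC : 0 ≤ C) (h : C ≤ C') :
    ENNReal.ofReal (C * S) ≤ ENNReal.ofReal (C' * S) := by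
  rcases le_total 0 S with hS | hS
  · exact ENNReal.ofReal_le_ofReal (by gcongr)
  · rw [ENNReal.ofReal_of_nonpos (mul_nonpos_of_nonneg_of_nonpos hC hS)]
    exact zero_le

/-- A common constant for finitely many estimates. -/
lemma exists_uniform_const {X : Type*} (k : ℕ) {T : ℕ → X → ℝ → ENNReal} {S : ℕ → X → ℝ → ℝ}
    (h : ∀ j, 2 ≤ j → ∃ C : ℝ, 0 < C ∧ ∀ (x : X) (t : ℝ), 1 < t →
      T j x t ≤ ENNReal.ofReal (C * S j x t)) :
    ∃ C : ℝ, 0 < C ∧ ∀ (x : X) (t : ℝ), 1 < t → ∀ j, 2 ≤ j → j ≤ k →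
      T j x t ≤ ENNReal.ofReal (C * S j x t) := by
  induction k with
  | zero => exact ⟨1, one_pos, fun x t _ j h1 h2 => by omega⟩
  | succ k ih =>
    obtain ⟨C, hC, hb⟩ := ih
    rcases lt_or_ge (k + 1) 2 with hk | hk
    · exact ⟨1, one_pos, fun x t _ j h1 h2 => by omega⟩
    obtain ⟨C', hC', hb'⟩ := h (k + 1) hk
    refine ⟨C + C', by positivity, fun x t ht j h1 h2 => ?_⟩
    rcases Nat.lt_or_ge k j with hj | hj
    · obtain rfl : j = k + 1 := by omega
      exact (hb' x t ht).trans (ofReal_mul_le_ofReal_mul hC'.le (by linarith))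
    · exact (hb x t ht j h1 hj).trans (ofReal_mul_le_ofReal_mul hC.le (by linarith))

end BubbleTower

theorem lemma5p1 (n k : ℕ) (s : ℝ) (hs0 : 0 < s) (hs1 : s < 1) (hn : 6 * s < (n : ℝ))
    (hk : 2 ≤ k) :
    ∃ t₀ : ℝ, 1 ≤ t₀ ∧
      ∀ α σ δ : ℝ, 0 < α → α < s → 0 < σ → σ < 1 → 0 < δ → δ * ((n : ℝ) - 4 * s) < σ →
        ∃ C : ℝ, 0 < C ∧ ∀ (x : EuclideanSpace ℝ (Fin n)) (t : ℝ), t₀ < t →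
          BubbleTower.Tout n s (BubbleTower.w11 n s α σ δ) x t
              ≤ ENNReal.ofReal (C * BubbleTower.w11Star n s α σ δ x t) ∧
          BubbleTower.Tout n s (BubbleTower.w11' n s α σ δ) x t
              ≤ ENNReal.ofReal (C * BubbleTower.w11'Star n s α σ δ x t) ∧
          (∀ j : ℕ, 2 ≤ j → j ≤ k →
            BubbleTower.Tout n s (BubbleTower.w1 n s α σ δ j) x t
              ≤ ENNReal.ofReal (C * BubbleTower.w1Star n s α σ δ j x t)) ∧
          BubbleTower.Tout n s (BubbleTower.w21 n s σ δ) x t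
              ≤ ENNReal.ofReal (C * BubbleTower.w21Star n s σ δ x t) ∧
          (∀ j : ℕ, 2 ≤ j → j ≤ k - 1 →
            BubbleTower.Tout n s (BubbleTower.w2 n s σ δ j) x t
              ≤ ENNReal.ofReal (C * BubbleTower.w2Star n s σ δ j x t)) ∧
          BubbleTower.Tout n s (BubbleTower.w3 n s σ δ) x t
              ≤ ENNReal.ofReal (C * BubbleTower.w3Star n s σ δ x t) ∧
          (∀ j : ℕ, 2 ≤ j → j ≤ k →
            BubbleTower.Tout n s (BubbleTower.w1' n s σ δ j) x t
              ≤ ENNReal.ofReal (C * BubbleTower.w1'Star n s σ δ j x t)) ∧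
          (∀ j : ℕ, 2 ≤ j → j ≤ k →
            BubbleTower.Tout n s (BubbleTower.w1'' n s σ δ j) x t
              ≤ ENNReal.ofReal (C * BubbleTower.w1''Star n s σ δ j x t)) := by
  -- All estimates hold for `t > 1`; no larger starting time is needed.
  refine ⟨1, le_rfl, fun α σ δ hα hαs hσ hσ1 hδ hδσ => ?_⟩
  obtain ⟨C₁, p₁, h₁⟩ := BubbleTower.Tout_w11_le n hs0 hn hα hαs hσ hσ1 hδ hδσ
  obtain ⟨C₂, p₂, h₂⟩ := BubbleTower.Tout_w11'_le n hs0 hn hα hαs hσ1 hδ hδσ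
  obtain ⟨C₃, p₃, h₃⟩ := BubbleTower.exists_uniform_const k fun j hj =>
    BubbleTower.Tout_w1_le n hs0 hn hα hαs hσ δ (j := j) hj
  obtain ⟨C₄, p₄, h₄⟩ := BubbleTower.Tout_w21_le n hs0 hn hσ δ
  obtain ⟨C₅, p₅, h₅⟩ := BubbleTower.exists_uniform_const (k - 1) fun j hj =>
    BubbleTower.Tout_w2_le n hs0 hn hσ δ (j := j) hj
  obtain ⟨C₆, p₆, h₆⟩ := BubbleTower.Tout_w3_le n hs0 hn hδ hδσ
  obtain ⟨C₇, p₇, h₇⟩ := BubbleTower.exists_uniform_const k fun j hj =>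
    BubbleTower.Tout_w1'_le n hs0 hn hσ δ (j := j) hj
  obtain ⟨C₈, p₈, h₈⟩ := BubbleTower.exists_uniform_const k fun j hj =>
    BubbleTower.Tout_w1''_le n hs0 hn hσ δ (j := j) hj
  refine ⟨C₁ + C₂ + C₃ + C₄ + C₅ + C₆ + C₇ + C₈, by positivity, fun x t ht => ?_⟩
  refine ⟨(h₁ x t ht).trans ?_, (h₂ x t ht).trans ?_, fun j h2 hj => (h₃ x t ht j h2 hj).trans ?_,
    (h₄ x t ht).trans ?_, fun j h2 hj => (h₅ x t ht j h2 hj).trans ?_, (h₆ x t ht).trans ?_,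
    fun j h2 hj => (h₇ x t ht j h2 hj).trans ?_, fun j h2 hj => (h₈ x t ht j h2 hj).trans ?_⟩
  all_goals exact BubbleTower.ofReal_mul_le_ofReal_mul (by positivity) (by linarith)
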